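/- For integers $n,m$ with $n\ge 1$, $m\ge 0$, put $C(n,m):=2\sum_{r=0}^{m-1}\binom{n-1}{r}$. Let $G(d,k)$ be the Grassmannian of $k$-dimensional linear subspaces of $\mathbb R^d$ and $\nu_k$ its rotation invariant (Haar) probability measure. For a closed convex cone $C\subset\mathbb R^d$, the conical quermassintegrals are $$U_j(C):=\frac12\int_{G(d,d-j)}\chi\bigl(C\cap\mathbb S^{d-1}\cap L\bigr)\,\nu_{d-j}(\mathrm dL),\qquad j=0,\dots,d,$$ where $\chi$ is the Euler characteristic. Let $d,n\ge 1$. (a) Let $\phi^*$ be a Borel probability measure on $G(d,d-1)$ that assigns measure zero to each set of hyperplanes containing a fixed line through $0$. The $(\phi^*,n)$-Schläfli cone $S_n$ is the random cone obtained by taking independent random hyperplanes $\mathcal H_1,\dots,\mathcal H_n$ with distribution $\phi^*$ and picking at random, with equal chances, one of the $d$-dimensional cones of the tessellation of $\mathbb R^d$ that they induce (i.e. one of the cones with interior points that are intersections of $n$ closed halfspaces, the $i$-th bounded by $\mathcal H_i$). Then, for $k=0,\dots,d-1$, $$\mathbb E\,U_k(S_n)=\frac{C(n,d-k)}{2\,C(n,d)}.$$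 (b) Let $\phi$ be a Borel probability measure on $\mathbb S^{d-1}$ that is invariant under $x\mapsto -x$ and assigns measure zero to each $(d-2)$-dimensional great subsphere. The $(\phi,n)$-Cover–Efron cone $C_n$ is the positive hull of independent random points $X_1,\dots,X_n$ with distribution $\phi$, under the condition that this positive hull is different from $\mathbb R^d$. Then, for $k=1,\dots,d-1$, $$\mathbb E\,U_k(C_n)=\frac{C(n,d)-C(n,k)}{2\,C(n,d)}.$$ -/

import Mathlib

noncomputable section

open MeasureTheory ProbabilityTheory
open scoped RealInnerProductSpace

/-- Euclidean space `ℝ^d`. -/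
abbrev Euc (d : ℕ) : Type := EuclideanSpace ℝ (Fin d)

/-! ### Grassmannians and their invariant measures -/

/-- The Grassmannian `G(d,k)` of `k`-dimensional linear subspaces of `ℝ^d`. -/
def Grassmann (d k : ℕ) : Type :=
  {L : Submodule ℝ (Euc d) // Module.finrank ℝ L = k}

/-- The underlying linear subspace of a point of the Grassmannian. -/
def Grassmann.toSubmodule {d k : ℕ} (L : Grassmann d k) : Submodule ℝ (Euc d) := L.1

/-- The usual topology on `G(d,k)`: two subspaces are close if the orthogonal projections
onto them are close (in operator norm). -/
instance (d k : ℕ) : TopologicalSpace (Grassmann d k) :=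
  TopologicalSpace.induced
    (fun L => (L.toSubmodule.starProjection : Euc d →L[ℝ] Euc d)) inferInstance

/-- Measures on `G(d,k)` are Borel measures. -/
instance (d k : ℕ) : MeasurableSpace (Grassmann d k) := borel _

instance (d k : ℕ) : BorelSpace (Grassmann d k) := ⟨rfl⟩

/-- The orthogonal group `O(d)`, as a topological group of continuous linear maps of `ℝ^d`. -/
abbrev OrthGroup (d : ℕ) : Type := unitary (Euc d →L[ℝ] Euc d)

instance (d : ℕ) : ContinuousStar (Euc d →L[ℝ] Euc d) :=
  ⟨(ContinuousLinearMap.adjoint (𝕜 := ℝ) (E := Euc d) (F := Euc d)).continuous⟩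

instance (d : ℕ) : CompactSpace (OrthGroup d) := by
  refine isCompact_iff_compactSpace.mp (Metric.isCompact_of_isClosed_isBounded ?_ ?_)
  · exact isClosed_unitary
  · refine (Metric.isBounded_iff_subset_closedBall 0).2 ⟨1, fun u hu => ?_⟩
    rw [mem_closedBall_zero_iff]
    refine ContinuousLinearMap.opNorm_le_bound _ zero_le_one fun x => ?_
    have h := (Unitary.linearIsometryEquiv ⟨u, hu⟩).norm_map x
    have h' : ‖u x‖ = ‖x‖ := h
    rw [h', one_mul]

/-- The Haar probability measure on `O(d)`. -/
def orthHaar (d : ℕ) : Measure (OrthGroup d) := Measure.haarMeasure ⊤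

/-- The subspace of `ℝ^d` spanned by the first `k` standard basis vectors. -/
def stdSubspace {d k : ℕ} (hk : k ≤ d) : Grassmann d k :=
  ⟨Submodule.span ℝ (Set.range fun i : Fin k => EuclideanSpace.basisFun (Fin d) ℝ (Fin.castLE hk i)),
    by
      rw [finrank_span_eq_card, Fintype.card_fin]
      exact (EuclideanSpace.basisFun (Fin d) ℝ).orthonormal.linearIndependent.comp _
        (Fin.castLE_injective hk)⟩

/-- The image of a subspace under an orthogonal transformation. -/
def OrthGroup.rotate {d k : ℕ} (u : OrthGroup d) (L : Grassmann d k) : Grassmann d k :=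
  ⟨L.toSubmodule.map ((Unitary.linearIsometryEquiv u).toLinearEquiv : Euc d →ₗ[ℝ] Euc d), by
    rw [LinearEquiv.finrank_map_eq]; exact L.2⟩

/-- The normalized Haar measure `ν_k` on `G(d,k)`: the distribution of the image of a fixed
`k`-dimensional subspace under a Haar distributed orthogonal transformation. It is the unique
rotation invariant Borel probability measure on `G(d,k)`. -/
def grassmannHaar {d k : ℕ} (hk : k ≤ d) : Measure (Grassmann d k) :=
  (orthHaar d).map fun u => OrthGroup.rotate u (stdSubspace hk)

/-! ### Conical quermassintegrals -/

/-- The Euler characteristic of a subset of `ℝ^d` (with the subspace topology), that is, the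
alternating sum of the ranks of its singular homology groups with rational coefficients. -/
def eulerChar {d : ℕ} (K : Set (Euc d)) : ℤ :=
  (((AlgebraicTopology.singularChainComplexFunctor (ModuleCat.{0} ℚ)).obj
    (ModuleCat.of ℚ ℚ)).obj (TopCat.of K)).homologyEulerChar

/-- The spherical quermassintegral
`U_j(K) = (1/2) ∫_{G(d,d-j)} χ(K ∩ L) ν_{d-j}(dL)` of a convex body `K` in the unit sphere
(for `j = 0, …, d`). -/
def sphericalQuermass {d : ℕ} (j : ℕ) (K : Set (Euc d)) : ℝ :=
  (1 / 2) * ∫ L : Grassmann d (d - j),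
    (eulerChar (K ∩ (L.toSubmodule : Set (Euc d))) : ℝ) ∂(grassmannHaar (Nat.sub_le d j))

/-- The conical quermassintegral `U_j(C) = U_j(C ∩ 𝕊^{d-1})` of a convex cone `C`. -/
def conicalQuermass {d : ℕ} (j : ℕ) (C : PointedCone ℝ (Euc d)) : ℝ :=
  sphericalQuermass j ((C : Set (Euc d)) ∩ Metric.sphere 0 1)

/-! ### Schläfli cones and Cover–Efron cones -/

/-- The number `C(n,d) = 2 ∑_{r=0}^{d-1} binom(n-1,r)` for `n ≥ 1`, and `C(0,d) = 1`. -/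
def schlafliNumber (n d : ℕ) : ℕ :=
  if n = 0 then 1 else 2 * ∑ r ∈ Finset.range d, (n - 1).choose r

/-- The Schläfli cones induced by hyperplanes `H_1, …, H_n`, i.e. the `d`-dimensional cones of the
tessellation: the intersections with interior points of closed halfspaces, one of the two closed
halfspaces bounded by `H_i` being chosen for each `i` (the choice is given by a normal vector
`x i` of `H_i`). -/
def schlafliCones {d n : ℕ} (H : Fin n → Grassmann d (d - 1)) : Set (PointedCone ℝ (Euc d)) :=
  {C | ∃ x : Fin n → Euc d, (∀ i, (ℝ ∙ x i)ᗮ = (H i).toSubmodule) ∧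
    (C : Set (Euc d)) = {y | ∀ i, ⟪y, x i⟫ ≤ 0} ∧ (interior (C : Set (Euc d))).Nonempty}

/-- The conditional expectation of `g(S)` given the hyperplanes `H_1, …, H_n`, where `S` is picked
at random, with equal chances, among the Schläfli cones induced by `H_1, …, H_n`
(of which there are finitely many). -/
def schlafliAverage {d n : ℕ} (g : PointedCone ℝ (Euc d) → ℝ)
    (H : Fin n → Grassmann d (d - 1)) : ℝ :=
  (∑ᶠ C ∈ schlafliCones H, g C) / (schlafliCones H).ncard

/-- The expectation of `g(S_n)` for the `(φ*,n)`-Schläfli cone `S_n`, which is obtained by a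
two-step experiment: take independent random hyperplanes `H_1, …, H_n` with distribution `φ*`,
then pick at random, with equal chances, one of the Schläfli cones induced by them. -/
def schlafliExpectation {d : ℕ} (φs : Measure (Grassmann d (d - 1))) (n : ℕ)
    (g : PointedCone ℝ (Euc d) → ℝ) : ℝ :=
  ∫ H, schlafliAverage g H ∂(Measure.pi fun _ : Fin n => φs)

/-- The positive hull of `n` points of the unit sphere. -/
def posHull {d n : ℕ} (x : Fin n → Metric.sphere (0 : Euc d) 1) : PointedCone ℝ (Euc d) :=
  PointedCone.hull ℝ (Set.range fun i => (x i : Euc d))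

/-- The distribution of `n` independent random points `X_1, …, X_n` in the unit sphere with
distribution `φ`, under the condition that their positive hull is different from `ℝ^d`. The
`(φ,n)`-Cover–Efron cone `C_n` is the positive hull of `X_1, …, X_n` under this measure. -/
def coverEfronMeasure {d : ℕ} (φ : Measure (Metric.sphere (0 : Euc d) 1)) (n : ℕ) :
    Measure (Fin n → Metric.sphere (0 : Euc d) 1) :=
  ProbabilityTheory.cond (Measure.pi fun _ : Fin n => φ) {x | posHull x ≠ ⊤}

/-- The expectation of `g(C_n)` for the `(φ,n)`-Cover–Efron cone `C_n`. -/
def coverEfronExpectation {d : ℕ} (φ : Measure (Metric.sphere (0 : Euc d) 1)) (n : ℕ)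
    (g : PointedCone ℝ (Euc d) → ℝ) : ℝ :=
  ∫ x, g (posHull x) ∂(coverEfronMeasure φ n)

end

noncomputable section

open MeasureTheory ProbabilityTheory
open scoped RealInnerProductSpace

/-! ### The Euler characteristic of contractible and of empty sets -/

/-! For almost every `L` in `G(d,d-k)` the section of the cone by the sphere and `L` is empty or
contractible, so its Euler characteristic is 0 or 1 and `U_k` is half the probability that `L` meets
the cone outside 0. Both kinds of cone turn this event into a sign condition on vectors `v i`. The
cone of all `y` with `⟪y, v i⟫ ≤ 0` meets `L` nontrivially iff some point of `L` has positive inner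
product with every `v i` (`conicalQuermass_of_generalPosition`). The positive hull of vectors in an
open halfspace misses `L` iff such a point exists in `Lᗮ`, by Gordan's alternative
(`conicalQuermass_hull`).

Now replace `v i` by `ε i • x i` and sum over all `2^n` sign vectors. For fixed `L` the sum counts
the regions cut out of `L` (or `Lᗮ`) by the hyperplanes orthogonal to the `x i`. In general position
this is the Schläfli number of the dimension (`ncard_signFeasible`), whatever the vectors are.

(a) The `C(n,d)` Schläfli cones are the realizable sign vectors, and their values of `U_k` sum to
`C(n,d-k)/2`; the average is thus almost surely constant. (b) As `φ` is even, all sign vectors are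
equally likely. So the hull differs from `ℝ^d` with probability `C(n,d)/2^n`, and the points are
strictly positive somewhere on a random `k`-dimensional `Lᗮ` with probability `C(n,k)/2^n`; dividing
gives the formula.

Genericity comes from `ae_orthHaar_disjoint` for the subspace, and from
`ae_vectorsInGeneralPosition` and `ae_normalsInGeneralPosition` for the vectors. -/

open CategoryTheory CategoryTheory.Limits AlgebraicTopology in
lemma homologyEulerChar_singular_of_isZero_pos (X : TopCat.{0})
    (h : ∀ i, i ≠ 0 →
      IsZero (((singularHomologyFunctor (ModuleCat.{0} ℚ) i).obj (ModuleCat.of ℚ ℚ)).obj X)) :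
    (((singularChainComplexFunctor (ModuleCat.{0} ℚ)).obj
      (ModuleCat.of ℚ ℚ)).obj X).homologyEulerChar =
    Module.finrank ℚ
      (((singularHomologyFunctor (ModuleCat.{0} ℚ) 0).obj (ModuleCat.of ℚ ℚ)).obj X) := by
  rw [HomologicalComplex.homologyEulerChar_eq_sum_finSet_of_finrankSupport_subset _ {0}]
  · simp
    rfl
  · rw [GradedObject.finrankSupport_subset_iff]
    intro i hi
    have hi' : i ≠ 0 := by simpa using hi
    have := ModuleCat.subsingleton_of_isZero (h i hi')
    exact Module.finrank_zero_of_subsingleton (R := ℚ) (M := (((singularHomologyFunctor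
      (ModuleCat.{0} ℚ) i).obj (ModuleCat.of ℚ ℚ)).obj X))

open CategoryTheory CategoryTheory.Limits AlgebraicTopology in
/-- A contractible space has the singular homology of a point. -/
lemma nonempty_singularHomology_iso_punit (X : TopCat.{0}) [ContractibleSpace X] (i : ℕ) :
    Nonempty (((singularHomologyFunctor (ModuleCat.{0} ℚ) i).obj (ModuleCat.of ℚ ℚ)).obj X ≅
      ((singularHomologyFunctor (ModuleCat.{0} ℚ) i).obj (ModuleCat.of ℚ ℚ)).obj
        (TopCat.of Unit)) := by
  obtain ⟨e⟩ := ContractibleSpace.hequiv_unit X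
  obtain ⟨hl⟩ := e.left_inv
  obtain ⟨hr⟩ := e.right_inv
  let F := (singularHomologyFunctor (ModuleCat.{0} ℚ) i).obj (ModuleCat.of ℚ ℚ)
  let f : X ⟶ TopCat.of Unit := TopCat.ofHom e.toFun
  let g : TopCat.of Unit ⟶ X := TopCat.ofHom e.invFun
  have h1 : F.map (f ≫ g) = F.map (𝟙 X) :=
    TopCat.Homotopy.congr_homologyMap_singularChainComplexFunctor (f := f ≫ g) (g := 𝟙 X) hl _ i
  have h2 : F.map (g ≫ f) = F.map (𝟙 _) :=
    TopCat.Homotopy.congr_homologyMap_singularChainComplexFunctor (f := g ≫ f) (g := 𝟙 _) hr _ i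
  exact ⟨⟨F.map f, F.map g, by rw [← F.map_comp, h1, F.map_id],
    by rw [← F.map_comp, h2, F.map_id]⟩⟩

open CategoryTheory CategoryTheory.Limits AlgebraicTopology in
lemma eulerChar_of_contractibleSpace {d : ℕ} (K : Set (Euc d)) [ContractibleSpace K] :
    eulerChar K = 1 := by
  have : ContractibleSpace (TopCat.of K) := ‹ContractibleSpace K›
  unfold eulerChar
  rw [homologyEulerChar_singular_of_isZero_pos]
  · obtain ⟨e⟩ := nonempty_singularHomology_iso_punit (TopCat.of K) 0
    have e' := e ≪≫ singularHomologyFunctorZeroOfTotallyDisconnectedSpace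
      (ModuleCat.{0} ℚ) (ModuleCat.of ℚ ℚ) (TopCat.of Unit)
    have e'' : (∐ fun _ : TopCat.of Unit ↦ ModuleCat.of ℚ ℚ) ≅ ModuleCat.of ℚ ℚ :=
      { hom := Sigma.desc fun _ => 𝟙 _
        inv := Sigma.ι (fun _ : TopCat.of Unit ↦ ModuleCat.of ℚ ℚ) ()
        hom_inv_id := by
          refine Sigma.hom_ext _ _ fun b => ?_
          cases b
          simp
        inv_hom_id := by simp }
    rw [(e' ≪≫ e'').toLinearEquiv.finrank_eq]
    exact_mod_cast Module.finrank_self ℚ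
  · intro i hi
    obtain ⟨e⟩ := nonempty_singularHomology_iso_punit (TopCat.of K) i
    exact (isZero_singularHomologyFunctor_of_totallyDisconnectedSpace _ i _ _ hi).of_iso e

open CategoryTheory CategoryTheory.Limits AlgebraicTopology in
lemma eulerChar_empty {d : ℕ} : eulerChar (∅ : Set (Euc d)) = 0 := by
  have : IsEmpty (TopCat.of (∅ : Set (Euc d))) := inferInstanceAs (IsEmpty (∅ : Set (Euc d)))
  unfold eulerChar
  rw [homologyEulerChar_singular_of_isZero_pos]
  · have e := singularHomologyFunctorZeroOfTotallyDisconnectedSpace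
      (ModuleCat.{0} ℚ) (ModuleCat.of ℚ ℚ) (TopCat.of (∅ : Set (Euc d)))
    have h0 : IsZero (∐ fun _ : TopCat.of (∅ : Set (Euc d)) ↦ ModuleCat.of ℚ ℚ) := by
      rw [IsZero.iff_id_eq_zero]
      exact Sigma.hom_ext _ _ fun b => isEmptyElim b
    have := ModuleCat.subsingleton_of_isZero (h0.of_iso e)
    exact_mod_cast Module.finrank_zero_of_subsingleton (R := ℚ)
  · intro i hi
    exact isZero_singularHomologyFunctor_of_totallyDisconnectedSpace _ i _ _ hi

/-- A convex cone which contains a point of the sphere but not the antipodal point has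
contractible intersection with the sphere. -/
lemma contractibleSpace_cone_inter_sphere {E : Type*} [NormedAddCommGroup E] [NormedSpace ℝ E]
    (C : PointedCone ℝ E) {p : E} (hp : p ∈ C) (hp1 : ‖p‖ = 1) (hpn : -p ∉ C) :
    ContractibleSpace ((C : Set E) ∩ Metric.sphere 0 1 : Set E) := by
  rw [contractible_iff_id_nullhomotopic]
  -- The contraction is the segment from `y` to `p`, pushed radially to the sphere. Unit vectors can
  -- cancel only at `t = 1/2` with `y = -p`, which is excluded.
  let w : unitInterval × ((C : Set E) ∩ Metric.sphere 0 1 : Set E) → E :=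
    fun z => (1 - (z.1 : ℝ)) • (z.2 : E) + (z.1 : ℝ) • p
  have hwc : Continuous w := by fun_prop
  have hw0 : ∀ z, w z ≠ 0 := by
    rintro ⟨⟨t, ht0, ht1⟩, ⟨y, hyC, hy⟩⟩ h
    have hy1 : ‖y‖ = 1 := by simpa using hy
    have h : (1 - t) • y + t • p = 0 := h
    have h1 : (1 - t) • y = -(t • p) := eq_neg_of_add_eq_zero_left h
    have h2 := congrArg norm h1
    rw [norm_neg, norm_smul, norm_smul, hy1, hp1, Real.norm_of_nonneg (by linarith),
      Real.norm_of_nonneg ht0] at h2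
    have h3 : t = 1 / 2 := by linarith
    subst h3
    have h4 : y = -p := by
      have : (1 / 2 : ℝ) • y = (1 / 2 : ℝ) • (-p) := by
        rw [smul_neg, ← h1]; norm_num
      exact smul_right_injective E (by norm_num : (1 / 2 : ℝ) ≠ 0) this
    exact hpn (h4 ▸ hyC)
  have hwC : ∀ z, w z ∈ C := by
    rintro ⟨⟨t, ht0, ht1⟩, ⟨y, hyC, hy⟩⟩
    exact C.add_mem (C.smul_mem (by simpa using ht1) hyC) (C.smul_mem ht0 hp)
  refine ⟨⟨p, hp, by simpa using hp1⟩, ⟨⟨⟨fun z => ⟨‖w z‖⁻¹ • w z,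
    C.smul_mem (by positivity) (hwC z), ?_⟩, ?_⟩, ?_, ?_⟩⟩⟩
  · simp [norm_smul, hw0 z]
  · refine Continuous.subtype_mk ?_ _
    exact (hwc.norm.inv₀ fun z => norm_ne_zero_iff.2 (hw0 z)).smul hwc
  · rintro ⟨y, hyC, hy⟩
    have hy1 : ‖y‖ = 1 := by simpa using hy
    ext
    simp [w, hy1]
  · rintro ⟨y, hyC, hy⟩
    ext
    simp [w, hp1]

/-! ### Sign patterns of linear functionals in general position -/

section SignPatterns

variable {E : Type*} [AddCommGroup E] [Module ℝ E]

/-- Linear functionals are in general position if any subfamily of at most `dim E` of them is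
linearly independent. -/
def InGeneralPosition {ι : Type*} (f : ι → Module.Dual ℝ E) : Prop :=
  ∀ J : Finset ι, J.card ≤ Module.finrank ℝ E → LinearIndepOn ℝ f (J : Set ι)

/-- The sign vector `ε` is realized (strictly) by the functionals `f` at some point. -/
def SignFeasible {ι : Type*} (f : ι → Module.Dual ℝ E) (ε : ι → ℤˣ) : Prop :=
  ∃ y, ∀ i, 0 < ((ε i : ℤ) : ℝ) * f i y

lemma InGeneralPosition.tail {n : ℕ} {f : Fin (n + 1) → Module.Dual ℝ E}
    (hf : InGeneralPosition f) : InGeneralPosition fun i : Fin n => f i.succ := by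
  intro J hJ
  have h := hf (J.map (Fin.succEmb n)) (by simpa using hJ)
  rw [linearIndepOn_finset_iff] at h ⊢
  intro c hc i hi
  have := h (Fin.cons 0 c) (by simpa using hc) i.succ (by simpa using hi)
  simpa using this

/-- A combination vanishing on `ker (f 0)` is a multiple of `f 0`, so a relation among restrictions
lifts to one that also involves `f 0`; the extra functional is paid for by the drop in dimension. -/
lemma InGeneralPosition.restrict_ker {n : ℕ} [FiniteDimensional ℝ E]
    {f : Fin (n + 1) → Module.Dual ℝ E} (hf : InGeneralPosition f) (h0 : f 0 ≠ 0) :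
    InGeneralPosition fun i : Fin n => (f i.succ).domRestrict (LinearMap.ker (f 0)) := by
  classical
  intro J hJ
  have hdim := Module.Dual.finrank_ker_add_one_of_ne_zero h0
  have h := hf (insert 0 (J.map (Fin.succEmb n)))
    ((Finset.card_insert_le _ _).trans (by rw [Finset.card_map]; omega))
  rw [linearIndepOn_finset_iff] at h ⊢
  intro c hc i hi
  have hker : (⨅ _ : Unit, LinearMap.ker (f 0)) ≤
      LinearMap.ker (∑ i ∈ J, c i • f i.succ) := by
    intro y hy
    have hy' : y ∈ LinearMap.ker (f 0) := by simpa using hy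
    have := LinearMap.congr_fun hc ⟨y, hy'⟩
    simpa using this
  have hs := mem_span_of_iInf_ker_le_ker (L := fun _ : Unit => f 0) hker
  rw [Set.range_const, Submodule.mem_span_singleton] at hs
  obtain ⟨a, ha⟩ := hs
  have := h (Fin.cons (-a) c) (by
    rw [Finset.sum_insert (by simp)]
    simp [ha]) i.succ (by simp [hi])
  simpa using this

lemma InGeneralPosition.ne_zero {ι : Type*} {f : ι → Module.Dual ℝ E} (hf : InGeneralPosition f)
    (h : 0 < Module.finrank ℝ E) (i : ι) : f i ≠ 0 := by
  have := hf {i} (by rw [Finset.card_singleton]; exact h)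
  simpa using this

lemma exists_perturb_signFeasible {n : ℕ} {f : Fin (n + 1) → Module.Dual ℝ E} {ε : Fin n → ℤˣ}
    {y : E} (hy : ∀ i : Fin n, 0 < ((ε i : ℤ) : ℝ) * f i.succ y) (z : E) :
    ∃ δ > (0 : ℝ), ∀ i : Fin n, 0 < ((ε i : ℤ) : ℝ) * f i.succ (y + δ • z) := by
  have : ∀ᶠ δ in nhdsWithin (0 : ℝ) (Set.Ioi 0),
      ∀ i : Fin n, 0 < ((ε i : ℤ) : ℝ) * f i.succ (y + δ • z) := by
    rw [Filter.eventually_all]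
    intro i
    apply eventually_nhdsWithin_of_eventually_nhds
    have hc : Continuous fun δ : ℝ => ((ε i : ℤ) : ℝ) * f i.succ (y + δ • z) := by
      simp only [map_add, map_smul, smul_eq_mul]
      fun_prop
    exact hc.continuousAt.eventually_const_lt (by simpa using hy i)
  obtain ⟨δ, h1, h2⟩ := (this.and self_mem_nhdsWithin).exists
  exact ⟨δ, h2, h1⟩

/-- Deletion: strict inequalities survive a small move, so a witness can be pushed off the
hyperplane `f 0 = 0`. -/
lemma signFeasible_cons_or_iff {n : ℕ} {f : Fin (n + 1) → Module.Dual ℝ E} (h0 : f 0 ≠ 0)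
    (ε : Fin n → ℤˣ) :
    (SignFeasible f (Fin.cons 1 ε) ∨ SignFeasible f (Fin.cons (-1) ε)) ↔
      SignFeasible (fun i => f i.succ) ε := by
  constructor
  · rintro (⟨y, hy⟩ | ⟨y, hy⟩) <;> exact ⟨y, fun i => by simpa using hy i.succ⟩
  · rintro ⟨y, hy⟩
    have key : ∀ y, (∀ i : Fin n, 0 < ((ε i : ℤ) : ℝ) * f i.succ y) → f 0 y ≠ 0 →
        (SignFeasible f (Fin.cons 1 ε) ∨ SignFeasible f (Fin.cons (-1) ε)) := by
      intro y hy hy0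
      rcases lt_or_gt_of_ne hy0 with h | h
      · exact Or.inr ⟨y, Fin.cases (by simpa using h) fun i => by simpa using hy i⟩
      · exact Or.inl ⟨y, Fin.cases (by simpa using h) fun i => by simpa using hy i⟩
    by_cases hy0 : f 0 y = 0
    · obtain ⟨z, hz⟩ : ∃ z, f 0 z ≠ 0 := by
        by_contra! h
        exact h0 (LinearMap.ext h)
      obtain ⟨δ, hδ, h⟩ := exists_perturb_signFeasible hy z
      exact key _ h (by simp [hy0, hz, hδ.ne'])
    · exact key y hy hy0

/-- Restriction: a region of the remaining hyperplanes is cut by `f 0 = 0` iff it has points on both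
sides. The segment between two such points crosses the hyperplane; conversely a point on it moves to
either side. -/
lemma signFeasible_cons_and_iff {n : ℕ} {f : Fin (n + 1) → Module.Dual ℝ E} (h0 : f 0 ≠ 0)
    (ε : Fin n → ℤˣ) :
    (SignFeasible f (Fin.cons 1 ε) ∧ SignFeasible f (Fin.cons (-1) ε)) ↔
      SignFeasible (fun i => (f i.succ).domRestrict (LinearMap.ker (f 0))) ε := by
  constructor
  · rintro ⟨⟨y, hy⟩, ⟨z, hz⟩⟩
    have hy0 : 0 < f 0 y := by simpa using hy 0
    have hz0 : f 0 z < 0 := by simpa using hz 0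
    refine ⟨⟨(-f 0 z) • y + f 0 y • z, by simp; ring⟩, fun i => ?_⟩
    have h1 : 0 < ((ε i : ℤ) : ℝ) * f i.succ y := by simpa using hy i.succ
    have h2 : 0 < ((ε i : ℤ) : ℝ) * f i.succ z := by simpa using hz i.succ
    have h3 := add_pos (mul_pos (neg_pos.2 hz0) h1) (mul_pos hy0 h2)
    simp only [LinearMap.domRestrict_apply, map_add, map_smul, smul_eq_mul]
    linarith
  · rintro ⟨⟨y, hy0⟩, hy⟩
    have hy0 : f 0 y = 0 := hy0
    have hy : ∀ i : Fin n, 0 < ((ε i : ℤ) : ℝ) * f i.succ y := hy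
    obtain ⟨z, hz⟩ : ∃ z, 0 < f 0 z := by
      by_contra! h
      refine h0 (LinearMap.ext fun z => le_antisymm (h z) ?_)
      have := h (-z)
      simpa using this
    constructor
    · obtain ⟨δ, hδ, h⟩ := exists_perturb_signFeasible hy z
      exact ⟨y + δ • z, Fin.cases (by simpa [hy0] using mul_pos hδ hz) fun i => by
        simpa only [Fin.cons_succ] using h i⟩
    · obtain ⟨δ, hδ, h⟩ := exists_perturb_signFeasible hy (-z)
      exact ⟨y + δ • -z, Fin.cases (by simpa [hy0] using mul_pos hδ hz) fun i => by
        simpa only [Fin.cons_succ] using h i⟩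

lemma ncard_signVectors_succ {n : ℕ} (P : (Fin (n + 1) → ℤˣ) → Prop) :
    {ε | P ε}.ncard = {ε : Fin n → ℤˣ | P (Fin.cons 1 ε)}.ncard +
      {ε : Fin n → ℤˣ | P (Fin.cons (-1) ε)}.ncard := by
  have h : {ε | P ε} = Fin.cons (α := fun _ => ℤˣ) 1 '' {ε : Fin n → ℤˣ | P (Fin.cons 1 ε)} ∪
      Fin.cons (α := fun _ => ℤˣ) (-1) '' {ε : Fin n → ℤˣ | P (Fin.cons (-1) ε)} := by
    ext ε
    constructor
    · intro hε
      have hc := Fin.cons_self_tail ε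
      rcases Int.units_eq_one_or (ε 0) with h | h <;> rw [h] at hc
      · exact Or.inl ⟨Fin.tail ε, by simpa [hc] using hε, hc⟩
      · exact Or.inr ⟨Fin.tail ε, by simpa [hc] using hε, hc⟩
    · rintro (⟨ε, hε, rfl⟩ | ⟨ε, hε, rfl⟩) <;> exact hε
  rw [h, Set.ncard_union_eq, Set.ncard_image_of_injective _ (Fin.cons_right_injective _),
    Set.ncard_image_of_injective _ (Fin.cons_right_injective _)]
  rw [Set.disjoint_left]
  rintro _ ⟨ε, -, rfl⟩ ⟨ε', -, h⟩
  have := congrFun h 0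
  simp at this

lemma schlafliNumber_succ_zero (n : ℕ) : schlafliNumber (n + 1) 0 = 0 := by
  simp [schlafliNumber]

/-- Pascal's rule; the convention `C(0,d) = 1` makes it valid from `n = 0` on. -/
lemma schlafliNumber_succ_succ (n d : ℕ) :
    schlafliNumber (n + 1) (d + 1) = schlafliNumber n (d + 1) + schlafliNumber n d := by
  rcases n with _ | n
  · simp [schlafliNumber, Finset.sum_range_succ']
  · simp only [schlafliNumber, Nat.add_sub_cancel, Nat.succ_ne_zero, if_false]
    rw [Finset.sum_range_succ', Finset.sum_range_succ' (fun r => n.choose r)]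
    simp only [Nat.choose_succ_succ, Nat.choose_zero_right, Finset.sum_add_distrib,
      Nat.succ_eq_add_one]
    ring

/-- Schläfli's count of the regions of a central hyperplane arrangement in general position. -/
theorem ncard_signFeasible (n : ℕ) : ∀ {E : Type*} [AddCommGroup E] [Module ℝ E]
    [FiniteDimensional ℝ E] (f : Fin n → Module.Dual ℝ E), InGeneralPosition f →
    {ε | SignFeasible f ε}.ncard = schlafliNumber n (Module.finrank ℝ E) := by
  induction n with
  | zero =>
    intro E _ _ _ f _
    have : {ε | SignFeasible f ε} = {finZeroElim} := by
      ext ε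
      simp [SignFeasible, Subsingleton.elim ε finZeroElim]
    simp [this, schlafliNumber]
  | succ n ih =>
    intro E _ _ _ f hf
    rcases Nat.eq_zero_or_pos (Module.finrank ℝ E) with hd | hd
    · have := Module.finrank_zero_iff.1 hd
      rw [hd, schlafliNumber_succ_zero]
      have : {ε | SignFeasible f ε} = ∅ := by
        ext ε
        simp only [Set.mem_ofPred_eq, Set.mem_empty_iff_false, iff_false]
        rintro ⟨y, hy⟩
        have := hy 0
        simp [Subsingleton.elim y 0] at this
      simp [this]
    -- Sign vectors are split by their first entry. Then `|A| + |B| = |A ∪ B| + |A ∩ B|`, where the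
    -- union counts the arrangement without `f 0` and the intersection the one induced on `ker (f
    -- 0)`.
    · have h0 := hf.ne_zero hd 0
      have hdim := Module.Dual.finrank_ker_add_one_of_ne_zero h0
      rw [ncard_signVectors_succ, ← Set.ncard_union_add_ncard_inter]
      have h1 : {ε : Fin n → ℤˣ | SignFeasible f (Fin.cons 1 ε)} ∪
          {ε | SignFeasible f (Fin.cons (-1) ε)} = {ε | SignFeasible (fun i => f i.succ) ε} := by
        ext ε; exact signFeasible_cons_or_iff h0 ε
      have h2 : {ε : Fin n → ℤˣ | SignFeasible f (Fin.cons 1 ε)} ∩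
          {ε | SignFeasible f (Fin.cons (-1) ε)} = {ε | SignFeasible (fun i =>
            (f i.succ).domRestrict (LinearMap.ker (f 0))) ε} := by
        ext ε; exact signFeasible_cons_and_iff h0 ε
      rw [h1, h2, ih _ hf.tail, ih _ (hf.restrict_ker h0), ← hdim, schlafliNumber_succ_succ]

lemma schlafliNumber_pos {n d : ℕ} (hd : 0 < d) : 0 < schlafliNumber n d := by
  unfold schlafliNumber
  split_ifs
  · exact one_pos
  · refine Nat.mul_pos two_pos (Finset.sum_pos' (fun _ _ => Nat.zero_le _)
      ⟨0, by simpa using hd, by simp⟩)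

/-- For functionals in general position, a sign vector that is weakly realized at a nonzero point
is strictly realized. -/
lemma InGeneralPosition.signFeasible_of_weak {ι : Type*} [Finite ι] [FiniteDimensional ℝ E]
    {f : ι → Module.Dual ℝ E} (hf : InGeneralPosition f) {ε : ι → ℤˣ} {y : E} (hy0 : y ≠ 0)
    (hy : ∀ i, 0 ≤ ((ε i : ℤ) : ℝ) * f i y) : SignFeasible f ε := by
  classical
  have := Fintype.ofFinite ι
  let I : Finset ι := {i | f i y = 0}
  -- Otherwise `dim E` independent functionals, which span the dual space, would vanish at `y ≠ 0`.
  have hI : I.card < Module.finrank ℝ E := by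
    by_contra! h
    obtain ⟨J, hJI, hJ⟩ := Finset.exists_subset_card_eq h
    have hli : LinearIndependent ℝ fun i : J => f i := hf J hJ.le
    have hspan := hli.span_eq_top_of_card_eq_finrank' (by
      rw [Fintype.card_coe, hJ, Subspace.dual_finrank_eq])
    refine hy0 ((Module.forall_dual_apply_eq_zero_iff ℝ y).1 fun g => ?_)
    have hg : g ∈ Submodule.span ℝ (Set.range fun i : J => f i) := hspan ▸ Submodule.mem_top
    induction hg using Submodule.span_induction with
    | mem g hg =>
      obtain ⟨i, rfl⟩ := hg
      have := hJI i.2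
      simpa [I] using this
    | zero => simp
    | add a b _ _ ha hb => simp [ha, hb]
    | smul c a _ ha => simp [ha]
  have hli : LinearIndependent ℝ fun i : I => f i := hf I hI.le
  -- Independent functionals take prescribed values: moving from `y` towards `z` gives the vanishing
  -- ones the right sign, and a small move keeps the others.
  obtain ⟨z, hz⟩ : ∃ z, ∀ i : I, f i z = ((ε i : ℤ) : ℝ) := by
    obtain ⟨Φ, hΦ⟩ := LinearMap.exists_extend
      ((Finsupp.linearCombination ℝ fun i : I => ((ε i : ℤ) : ℝ)) ∘ₗ hli.repr)
    refine ⟨(Module.evalEquiv ℝ E).symm Φ, fun i => ?_⟩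
    have h1 := LinearMap.congr_fun hΦ ⟨f i, Submodule.subset_span ⟨i, rfl⟩⟩
    simp only [LinearMap.comp_apply, Submodule.subtype_apply] at h1
    rw [Module.apply_evalEquiv_symm_apply, h1, hli.repr_eq_single i _ rfl]
    simp
  have : ∀ᶠ δ in nhdsWithin (0 : ℝ) (Set.Ioi 0), ∀ i, 0 < ((ε i : ℤ) : ℝ) * f i (y + δ • z) := by
    rw [Filter.eventually_all]
    intro i
    by_cases hi : f i y = 0
    · filter_upwards [self_mem_nhdsWithin] with δ hδ
      rw [map_add, hi, map_smul, hz ⟨i, by simpa [I] using hi⟩]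
      rcases Int.units_eq_one_or (ε i) with h | h <;> simpa [h] using hδ
    · apply eventually_nhdsWithin_of_eventually_nhds
      have hc : Continuous fun δ : ℝ => ((ε i : ℤ) : ℝ) * f i (y + δ • z) := by
        simp only [map_add, map_smul, smul_eq_mul]
        fun_prop
      refine hc.continuousAt.eventually_const_lt ?_
      have h1 : ((ε i : ℤ) : ℝ) ≠ 0 := by simp
      simpa using lt_of_le_of_ne (hy i) (mul_ne_zero h1 hi).symm
  obtain ⟨δ, h⟩ := this.exists
  exact ⟨_, h⟩

/-- Gordan's alternative. -/
lemma exists_nonneg_sum_eq_zero_of_not_signFeasible {ι : Type*} [Fintype ι]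
    [FiniteDimensional ℝ E] {f : ι → Module.Dual ℝ E} {ε : ι → ℤˣ} (h : ¬ SignFeasible f ε) :
    ∃ c : ι → ℝ, (∀ i, 0 ≤ c i) ∧ c ≠ 0 ∧ ∑ i, c i • (((ε i : ℤ) : ℝ) • f i) = 0 := by
  classical
  let T : E →ₗ[ℝ] (ι → ℝ) := LinearMap.pi fun i => ((ε i : ℤ) : ℝ) • f i
  have hT : ∀ y i, T y i = ((ε i : ℤ) : ℝ) * f i y := fun y i => rfl
  let U : Set (ι → ℝ) := Set.univ.pi fun _ => Set.Ioi 0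
  have hU : ∀ a, a ∈ U ↔ ∀ i, 0 < a i := fun a => by simp [U]
  -- The range of `T` misses the open positive orthant, so a functional separates them. Being
  -- bounded below on a subspace it vanishes there; its negated coordinates are the required
  -- coefficients.
  obtain ⟨φ, c, h1, h2⟩ := geometric_hahn_banach_open (s := U) (t := LinearMap.range T)
    (convex_pi fun _ _ => convex_Ioi 0) (isOpen_set_pi Set.finite_univ fun _ _ => isOpen_Ioi)
    (LinearMap.range T).convex (by
      rw [Set.disjoint_left]
      rintro _ ha ⟨y, rfl⟩
      exact h ⟨y, (hU _).1 ha⟩)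
  have hc : c ≤ 0 := by simpa using h2 0 (LinearMap.range T).zero_mem
  have hφT : ∀ y, φ (T y) = 0 := by
    intro y
    by_contra hne
    have := h2 (T (((c - 1) / φ (T y)) • y)) ⟨_, rfl⟩
    rw [map_smul, map_smul, smul_eq_mul, div_mul_cancel₀ _ hne] at this
    linarith
  have hφ : ∀ a : ι → ℝ, φ a = ∑ i, a i * φ (Pi.single i 1) := by
    intro a
    conv_lhs => rw [pi_eq_sum_univ' a]
    simp [map_sum]
  refine ⟨fun i => -φ (Pi.single i 1), fun i => ?_, fun h0 => ?_, ?_⟩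
  · rw [neg_nonneg]
    -- The basis vector lies only on the boundary of the open orthant, so the sign of `φ` there is
    -- obtained as a limit from inside.
    have hlim : Filter.Tendsto (fun δ : ℝ => φ (Pi.single i 1 + δ • 1)) (nhdsWithin 0 (Set.Ioi 0))
        (nhds (φ (Pi.single i 1 + (0 : ℝ) • 1))) := by
      refine (Continuous.tendsto ?_ 0).mono_left nhdsWithin_le_nhds
      fun_prop
    rw [zero_smul, add_zero] at hlim
    refine le_of_tendsto hlim ?_
    filter_upwards [self_mem_nhdsWithin] with δ hδ
    refine ((h1 _ ((hU _).2 fun j => ?_)).trans_le hc).le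
    have h3 : (0 : ℝ) ≤ (Pi.single i 1 : ι → ℝ) j := by
      rw [Pi.single_apply]; split_ifs <;> norm_num
    have h4 : (0 : ℝ) < δ := hδ
    simp only [Pi.add_apply, Pi.smul_apply, Pi.one_apply, smul_eq_mul, mul_one]
    linarith
  · have h3 := h1 1 ((hU _).2 fun _ => one_pos)
    rw [hφ] at h3
    have : ∀ i, φ (Pi.single i 1) = 0 := fun i => by simpa using congrFun h0 i
    simp [this] at h3
    linarith
  · ext y
    have := hφT y
    rw [hφ] at this
    simp only [hT] at this
    simp only [LinearMap.sum_apply, LinearMap.smul_apply, smul_eq_mul, LinearMap.zero_apply,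
      neg_mul, Finset.sum_neg_distrib, neg_eq_zero]
    rw [← this]
    exact Finset.sum_congr rfl fun i _ => by ring

end SignPatterns

/-! ### Subspaces in random position -/

section RandomSubspace

variable {d : ℕ}

instance : (orthHaar d).IsHaarMeasure := by unfold orthHaar; infer_instance

instance : IsProbabilityMeasure (orthHaar d) := ⟨by
  have := Measure.haarMeasure_self (K₀ := (⊤ : TopologicalSpace.PositiveCompacts (OrthGroup d)))
  simpa [orthHaar] using this⟩

lemma OrthGroup.norm_apply (u : OrthGroup d) (y : Euc d) :
    ‖(u : Euc d →L[ℝ] Euc d) y‖ = ‖y‖ :=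
  (Unitary.linearIsometryEquiv u).norm_map y

/-- Supplies measurability: restricting `y` to the compact unit sphere of `M` makes the set a
projection along a compact factor, hence closed. -/
lemma OrthGroup.isClosed_setOf_exists_mem (M W : Submodule ℝ (Euc d)) :
    IsClosed {u : OrthGroup d | ∃ y ∈ M, y ≠ 0 ∧ (u : Euc d →L[ℝ] Euc d) y ∈ W} := by
  have hK : IsCompact ((M : Set (Euc d)) ∩ Metric.sphere 0 1) :=
    (isCompact_sphere 0 1).inter_left M.closed_of_finiteDimensional
  have : CompactSpace ((M : Set (Euc d)) ∩ Metric.sphere 0 1 : Set (Euc d)) :=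
    isCompact_iff_compactSpace.1 hK
  have hcl : IsClosed {p : ((M : Set (Euc d)) ∩ Metric.sphere 0 1 : Set (Euc d)) × OrthGroup d |
      (p.2 : Euc d →L[ℝ] Euc d) p.1 ∈ W} :=
    W.closed_of_finiteDimensional.preimage (f := fun p :
      ((M : Set (Euc d)) ∩ Metric.sphere 0 1 : Set (Euc d)) × OrthGroup d =>
        (p.2 : Euc d →L[ℝ] Euc d) p.1) (by fun_prop)
  convert isClosedMap_snd_of_compactSpace _ hcl using 1
  ext u
  constructor
  · rintro ⟨y, hyM, hy0, hyW⟩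
    refine ⟨(⟨‖y‖⁻¹ • y, M.smul_mem _ hyM, by simp [norm_smul, hy0]⟩, u), ?_, rfl⟩
    simpa using W.smul_mem _ hyW
  · rintro ⟨⟨⟨y, hyM, hy⟩, u⟩, h, rfl⟩
    exact ⟨y, hyM, by rintro rfl; simp at hy, h⟩

/-- A curve in a subspace `K` which meets each proper subspace of `K` only finitely often. -/
lemma exists_curve_finite_preimage (K : Submodule ℝ (Euc d)) (hK : K ≠ ⊥) :
    ∃ γ : ℕ → Euc d, (∀ t, γ t ∈ K ∧ γ t ≠ 0) ∧
      ∀ y ∈ K, y ≠ 0 → {t | ⟪y, γ t⟫ = 0}.Finite := by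
  let b := Module.finBasis ℝ K
  have hk : 0 < Module.finrank ℝ K :=
    Nat.pos_of_ne_zero fun h => hK (Submodule.finrank_eq_zero.1 h)
  -- The moment curve: `⟪y, g t⟫` is a polynomial in `t` whose coefficients are the products of `y`
  -- with the basis. The coefficient of the first basis vector is always 1 (also at `t = 0`), so the
  -- curve avoids 0.
  let g : ℕ → K := fun t => ∑ i : Fin (Module.finrank ℝ K), ((t : ℝ) ^ (i : ℕ)) • b i
  refine ⟨fun t => g t, fun t => ⟨(g t).2, fun h => ?_⟩, fun y hy hy0 => ?_⟩
  · have h0 : g t = 0 := Subtype.ext h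
    have := Fintype.linearIndependent_iff.1 b.linearIndependent _ h0 ⟨0, hk⟩
    simp at this
  · let p : Polynomial ℝ := ∑ i, Polynomial.C ⟪y, b i⟫ * Polynomial.X ^ (i : ℕ)
    have hp : p ≠ 0 := by
      intro h
      have hc : ∀ i, ⟪y, (b i : Euc d)⟫ = 0 := by
        intro i
        have := congrArg (fun q => Polynomial.coeff q (i : ℕ)) h
        simpa [p, Polynomial.finsetSum_coeff, Polynomial.coeff_C_mul_X_pow, Fin.val_inj] using this
      apply hy0
      have hy' : ∀ z : K, ⟪y, (z : Euc d)⟫ = 0 := by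
        intro z
        rw [← b.sum_repr z]
        simp only [Submodule.coe_sum, Submodule.coe_smul, inner_sum, inner_smul_right, hc,
          mul_zero, Finset.sum_const_zero]
      exact inner_self_eq_zero.1 (hy' ⟨y, hy⟩)
    have hfin : {t : ℝ | p.IsRoot t}.Finite := Polynomial.finite_setOfPred_isRoot hp
    refine (hfin.preimage (Nat.cast_injective (R := ℝ)).injOn).subset fun t ht => ?_
    have ht : ⟪y, (g t : Euc d)⟫ = 0 := ht
    change p.eval (t : ℝ) = 0
    rw [← ht]
    simp only [p, g, Polynomial.eval_finsetSum, Submodule.coe_sum, Submodule.coe_smul, inner_sum,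
      inner_smul_right, Polynomial.eval_mul, Polynomial.eval_C, Polynomial.eval_pow,
      Polynomial.eval_X]
    exact Finset.sum_congr rfl fun i _ => mul_comm _ _

/-- If `dim W + dim M ≤ d`, then a random rotation of `M` meets `W` only in `0`. -/
lemma ae_orthHaar_disjoint (M : Submodule ℝ (Euc d)) : ∀ (m : ℕ) (W : Submodule ℝ (Euc d)),
    Module.finrank ℝ W = m → m + Module.finrank ℝ M ≤ d →
    ∀ᵐ (u : OrthGroup d) ∂(orthHaar d), ¬ ∃ y ∈ M, y ≠ 0 ∧ (u : Euc d →L[ℝ] Euc d) y ∈ W := by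
  intro m
  induction m with
  | zero =>
    intro W hW _
    rw [Submodule.finrank_eq_zero.1 hW]
    refine Filter.Eventually.of_forall ?_
    rintro u ⟨y, -, hy0, hy⟩
    rw [Submodule.mem_bot, ← norm_eq_zero, OrthGroup.norm_apply, norm_eq_zero] at hy
    exact hy0 hy
  | succ m ih =>
    intro W hW hd
    obtain ⟨w, hwW, hw0⟩ := W.exists_mem_ne_zero_of_ne_bot (by
      rintro rfl; simp at hW)
    let W' := (ℝ ∙ w)ᗮ ⊓ W
    have hW'm : Module.finrank ℝ W' = m := by
      have := Submodule.finrank_add_inf_finrank_orthogonal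
        ((Submodule.span_singleton_le_iff_mem w W).2 hwW)
      rw [finrank_span_singleton hw0] at this
      change Module.finrank ℝ ((ℝ ∙ w)ᗮ ⊓ W : Submodule ℝ (Euc d)) = m
      omega
    have hwW' : ∀ a ∈ W', ⟪a, w⟫ = 0 := fun a ha => by
      rw [real_inner_comm]; exact Submodule.mem_orthogonal_singleton_iff_inner_right.1 ha.1
    have hdec : ∀ y ∈ W, ∃ a ∈ W', ∃ s : ℝ, y = a + s • w := by
      intro y hy
      refine ⟨y - (⟪w, y⟫ / ⟪w, w⟫) • w, ⟨?_, W.sub_mem hy (W.smul_mem _ hwW)⟩, _,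
        (sub_add_cancel _ _).symm⟩
      have : ⟪w, w⟫ ≠ 0 := fun h => hw0 (inner_self_eq_zero.1 h)
      refine Submodule.mem_orthogonal_singleton_iff_inner_right.2 ?_
      rw [inner_sub_right, inner_smul_right, div_mul_cancel₀ _ this, sub_self]
    have hwK : w ∈ W'ᗮ := (Submodule.mem_orthogonal _ _).2 hwW'
    obtain ⟨γ, hγ, hfin⟩ := exists_curve_finite_preimage W'ᗮ
      (fun h => hw0 (by simpa [h] using hwK))
    let c : ℕ → ℝ := fun t => ‖w‖ / ‖γ t‖
    have hc : ∀ t, c t ≠ 0 := fun t =>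
      div_ne_zero (norm_ne_zero_iff.2 hw0) (norm_ne_zero_iff.2 (hγ t).2)
    -- The reflection fixes `W'` pointwise and swaps `w` with a multiple of `γ t`, so it carries `W`
    -- to `W'` plus the line of `γ t`.
    let v : ℕ → OrthGroup d := fun t =>
      Unitary.linearIsometryEquiv.symm (ℝ ∙ (w - c t • γ t))ᗮ.reflection
    have hv : ∀ t y, (v t : Euc d →L[ℝ] Euc d) y = (ℝ ∙ (w - c t • γ t))ᗮ.reflection y :=
      fun t y => rfl
    have hvw : ∀ t, (ℝ ∙ (w - c t • γ t))ᗮ.reflection w = c t • γ t := by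
      intro t
      refine Submodule.reflection_sub ?_
      rw [norm_smul, Real.norm_of_nonneg (by positivity),
        div_mul_cancel₀ _ (norm_ne_zero_iff.2 (hγ t).2)]
    have hva : ∀ t, ∀ a ∈ W', (ℝ ∙ (w - c t • γ t))ᗮ.reflection a = a := by
      intro t a ha
      refine Submodule.reflection_mem_subspace_eq_self ?_
      rw [Submodule.mem_orthogonal_singleton_iff_inner_left, inner_sub_right, inner_smul_right,
        hwW' a ha, (Submodule.mem_orthogonal _ _).1 (hγ t).1 a ha]
      simp
    let A : Set (OrthGroup d) := {u | ∃ y ∈ M, y ≠ 0 ∧ (u : Euc d →L[ℝ] Euc d) y ∈ W}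
    have hA : MeasurableSet A := (OrthGroup.isClosed_setOf_exists_mem M W).measurableSet
    -- By invariance all the sets `{u | v t * u ∈ A}` have the measure of `A`. If almost every `u`
    -- lies in only finitely many of them, dominated convergence forces this common measure to be 0.
    have hlim : Filter.Tendsto (fun t => orthHaar d ((fun u => v t * u) ⁻¹' A)) Filter.atTop
        (nhds (orthHaar d ∅)) := by
      refine tendsto_measure_of_ae_tendsto_indicator _ MeasurableSet.empty
        (fun t => hA.preimage (measurable_const_mul (v t))) MeasurableSet.univ
        (measure_ne_top _ _) (Filter.Eventually.of_forall fun _ => Set.subset_univ _) ?_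
      filter_upwards [ih W' hW'm (by omega)] with u hu
      -- Let `u` keep `M` away from `W'`. If `v t * u` is in `A`, a vector of `u M` has a nonzero
      -- component along `γ t` modulo `W'`, so `γ t ∈ N`. Since `N` is proper by dimension, `γ t` is
      -- orthogonal to a fixed `y ≠ 0` in `W'ᗮ`, which happens for finitely many `t` only.
      let N : Submodule ℝ (Euc d) := W' ⊔ M.map (u : Euc d →L[ℝ] Euc d).toLinearMap
      have hN : N ≠ ⊤ := by
        intro h
        have h1 := Submodule.finrank_add_le_finrank_add_finrank W'
          (M.map (u : Euc d →L[ℝ] Euc d).toLinearMap)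
        have h2 := Submodule.finrank_map_le (u : Euc d →L[ℝ] Euc d).toLinearMap M
        change Module.finrank ℝ N ≤ _ at h1
        rw [h, finrank_top, finrank_euclideanSpace_fin, hW'm] at h1
        omega
      obtain ⟨y, hyN, hy0⟩ := Nᗮ.exists_mem_ne_zero_of_ne_bot
        (fun h => hN (Submodule.orthogonal_eq_bot_iff.1 h))
      have hyW' : y ∈ W'ᗮ := Submodule.orthogonal_le le_sup_left hyN
      rw [← Nat.cofinite_eq_atTop]
      refine Filter.mem_of_superset (hfin y hyW' hy0).compl_mem_cofinite fun t ht => ?_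
      simp only [Set.mem_ofPred_eq, Set.mem_empty_iff_false, iff_false]
      rintro ⟨z, hzM, hz0, hzW⟩
      apply ht
      obtain ⟨a, ha, s, hs⟩ := hdec _ hzW
      have hs' : (u : Euc d →L[ℝ] Euc d) z = a + (s * c t) • γ t := by
        have h1 : (ℝ ∙ (w - c t • γ t))ᗮ.reflection ((u : Euc d →L[ℝ] Euc d) z) = a + s • w := hs
        have h2 := congrArg (ℝ ∙ (w - c t • γ t))ᗮ.reflection h1
        rw [Submodule.reflection_reflection, map_add, map_smul, hva t a ha, hvw] at h2
        rw [h2, smul_smul]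
      have hs0 : s * c t ≠ 0 := by
        intro h
        rw [h, zero_smul, add_zero] at hs'
        exact hu ⟨z, hzM, hz0, hs' ▸ ha⟩
      have hγN : γ t ∈ N := by
        have h3 : γ t = (s * c t)⁻¹ • ((u : Euc d →L[ℝ] Euc d) z - a) := by
          rw [hs', add_sub_cancel_left, smul_smul, inv_mul_cancel₀ hs0, one_smul]
        rw [h3]
        exact N.smul_mem _ (N.sub_mem (Submodule.mem_sup_right ⟨z, hzM, rfl⟩)
          (Submodule.mem_sup_left ha))
      exact (Submodule.mem_orthogonal' _ _).1 hyN _ hγN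
    simp only [measure_preimage_mul, measure_empty] at hlim
    have hA0 : orthHaar d A = 0 := tendsto_nhds_unique tendsto_const_nhds hlim
    exact measure_eq_zero_iff_ae_notMem.1 hA0

lemma OrthGroup.toSubmodule_rotate {j : ℕ} (u : OrthGroup d) (L : Grassmann d j) :
    (OrthGroup.rotate u L).toSubmodule = L.toSubmodule.map
      ((Unitary.linearIsometryEquiv u).toLinearEquiv : Euc d →ₗ[ℝ] Euc d) := rfl

lemma OrthGroup.continuous_rotate {j : ℕ} (L : Grassmann d j) :
    Continuous fun u : OrthGroup d => OrthGroup.rotate u L := by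
  rw [continuous_induced_rng]
  have : (fun M : Grassmann d j => (M.toSubmodule.starProjection : Euc d →L[ℝ] Euc d)) ∘
      (fun u : OrthGroup d => OrthGroup.rotate u L) = fun u : OrthGroup d =>
        (u : Euc d →L[ℝ] Euc d) * L.toSubmodule.starProjection *
          (star u : Euc d →L[ℝ] Euc d) := by
    ext1 u
    refine ContinuousLinearMap.ext fun y => ?_
    have := Submodule.starProjection_map_apply (Unitary.linearIsometryEquiv u) L.toSubmodule y
    exact this
  rw [this]
  fun_prop

instance {j : ℕ} (hj : j ≤ d) : IsProbabilityMeasure (grassmannHaar hj) :=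
  Measure.isProbabilityMeasure_map (OrthGroup.continuous_rotate _).measurable.aemeasurable

lemma Grassmann.continuous_starProjection {j : ℕ} :
    Continuous fun L : Grassmann d j => (L.toSubmodule.starProjection : Euc d →L[ℝ] Euc d) :=
  continuous_induced_dom

lemma Grassmann.isClosed_setOf_exists_mem {j : ℕ} {K : Set (Euc d)} (hK : IsClosed K) :
    IsClosed {L : Grassmann d j | ∃ y ∈ K, ‖y‖ = 1 ∧ y ∈ L.toSubmodule} := by
  have hK : IsCompact (K ∩ Metric.sphere 0 1) := (isCompact_sphere 0 1).inter_left hK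
  have : CompactSpace (K ∩ Metric.sphere 0 1 : Set (Euc d)) := isCompact_iff_compactSpace.1 hK
  have hcl : IsClosed {p : (K ∩ Metric.sphere 0 1 : Set (Euc d)) × Grassmann d j |
      p.2.toSubmodule.starProjection (p.1 : Euc d) = p.1} := by
    refine isClosed_eq ?_ (continuous_subtype_val.comp continuous_fst)
    exact (Grassmann.continuous_starProjection.comp continuous_snd).clm_apply
      (continuous_subtype_val.comp continuous_fst)
  convert isClosedMap_snd_of_compactSpace _ hcl using 1
  ext L
  constructor
  · rintro ⟨y, hyK, hy, hyL⟩
    exact ⟨(⟨y, hyK, by simpa using hy⟩, L), Submodule.starProjection_eq_self_iff.2 hyL, rfl⟩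
  · rintro ⟨⟨⟨y, hyK, hy⟩, L⟩, h, rfl⟩
    exact ⟨y, hyK, by simpa using hy, Submodule.starProjection_eq_self_iff.1 h⟩

lemma Grassmann.finrank_toSubmodule {j : ℕ} (L : Grassmann d j) :
    Module.finrank ℝ L.toSubmodule = j := L.2

lemma Grassmann.finrank_orthogonal {j : ℕ} (L : Grassmann d j) :
    Module.finrank ℝ L.toSubmoduleᗮ = d - j := by
  have := L.toSubmodule.finrank_add_finrank_orthogonal
  rw [L.finrank_toSubmodule, finrank_euclideanSpace_fin] at this
  omega

lemma Submodule.inf_eq_bot_iff_unit {W L : Submodule ℝ (Euc d)} :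
    W ⊓ L = ⊥ ↔ ¬ ∃ y ∈ (W : Set (Euc d)), ‖y‖ = 1 ∧ y ∈ L := by
  rw [Submodule.eq_bot_iff]
  constructor
  · rintro h ⟨y, hyW, hy, hyL⟩
    rw [h y ⟨hyW, hyL⟩] at hy
    simp at hy
  · rintro h y ⟨hyW, hyL⟩
    by_contra hy
    exact h ⟨‖y‖⁻¹ • y, W.smul_mem _ hyW, by simp [norm_smul, hy], L.smul_mem _ hyL⟩

lemma Grassmann.ae_inf_eq_bot {j : ℕ} (hj : j ≤ d) {W : Submodule ℝ (Euc d)}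
    (hW : Module.finrank ℝ W + j ≤ d) :
    ∀ᵐ L ∂(grassmannHaar hj), W ⊓ L.toSubmodule = ⊥ := by
  simp only [Submodule.inf_eq_bot_iff_unit]
  refine (ae_map_iff (OrthGroup.continuous_rotate _).measurable.aemeasurable
    (Grassmann.isClosed_setOf_exists_mem W.closed_of_finiteDimensional).measurableSet.compl).2 ?_
  filter_upwards [ae_orthHaar_disjoint (stdSubspace hj).toSubmodule _ W rfl
    (by rwa [Grassmann.finrank_toSubmodule])] with u hu
  rintro ⟨_, hyW, hy, y, hyM, rfl⟩
  exact hu ⟨y, hyM, by rintro rfl; simp at hy, hyW⟩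

lemma Grassmann.isOpen_setOf_inf_orthogonal_eq_bot {j : ℕ} (W : Submodule ℝ (Euc d)) :
    IsOpen {L : Grassmann d j | W ⊓ L.toSubmoduleᗮ = ⊥} := by
  simp only [Submodule.inf_eq_bot_iff_unit]
  rw [← isClosed_compl_iff]
  have hK : IsCompact ((W : Set (Euc d)) ∩ Metric.sphere 0 1) :=
    (isCompact_sphere 0 1).inter_left W.closed_of_finiteDimensional
  have : CompactSpace ((W : Set (Euc d)) ∩ Metric.sphere 0 1 : Set (Euc d)) :=
    isCompact_iff_compactSpace.1 hK
  have hcl : IsClosed {p : ((W : Set (Euc d)) ∩ Metric.sphere 0 1 : Set (Euc d)) × Grassmann d j |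
      p.2.toSubmodule.starProjection (p.1 : Euc d) = 0} := by
    refine isClosed_eq ?_ continuous_const
    exact (Grassmann.continuous_starProjection.comp continuous_snd).clm_apply
      (continuous_subtype_val.comp continuous_fst)
  convert isClosedMap_snd_of_compactSpace _ hcl using 1
  ext L
  simp only [Set.mem_compl_iff, Set.mem_ofPred_eq, not_not]
  constructor
  · rintro ⟨y, hyK, hy, hyL⟩
    exact ⟨(⟨y, hyK, by simpa using hy⟩, L), (Submodule.starProjection_apply_eq_zero_iff _).2 hyL, rfl⟩
  · rintro ⟨⟨⟨y, hyK, hy⟩, L⟩, h, rfl⟩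
    exact ⟨y, hyK, by simpa using hy, (Submodule.starProjection_apply_eq_zero_iff _).1 h⟩

lemma Grassmann.ae_inf_orthogonal_eq_bot {j : ℕ} (hj : j ≤ d) {W : Submodule ℝ (Euc d)}
    (hW : Module.finrank ℝ W ≤ j) :
    ∀ᵐ L ∂(grassmannHaar hj), W ⊓ L.toSubmoduleᗮ = ⊥ := by
  refine (ae_map_iff (OrthGroup.continuous_rotate _).measurable.aemeasurable
    (Grassmann.isOpen_setOf_inf_orthogonal_eq_bot W).measurableSet).2 ?_
  filter_upwards [ae_orthHaar_disjoint (stdSubspace hj).toSubmoduleᗮ _ W rfl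
    (by rw [Grassmann.finrank_orthogonal]; omega)] with u hu
  rw [Submodule.inf_eq_bot_iff_unit, OrthGroup.toSubmodule_rotate, ← Submodule.map_orthogonal_equiv]
  rintro ⟨_, hyW, hy, y, hyM, rfl⟩
  exact hu ⟨y, hyM, by rintro rfl; simp at hy, hyW⟩

end RandomSubspace

/-! ### Random vectors in general position -/

section RandomVectors

/-- Fubini in the single coordinate `i`: averaging over that coordinate alone leaves the integral of
the indicator unchanged. -/
lemma measure_pi_eq_zero_of_update {ι X : Type*} [Fintype ι] [DecidableEq ι] [MeasurableSpace X]
    (φ : Measure X) [IsProbabilityMeasure φ] {A : Set (ι → X)} (hA : MeasurableSet A) (i : ι)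
    (h : ∀ᵐ x ∂(Measure.pi fun _ : ι => φ), ∀ᵐ y ∂φ, Function.update x i y ∉ A) :
    Measure.pi (fun _ : ι => φ) A = 0 := by
  let f : (ι → X) → ENNReal := A.indicator 1
  have hf : Measurable f := measurable_one.indicator hA
  let g : (ι → X) → ENNReal := lmarginal (fun _ => φ) {i} f
  have hg : Measurable g := hf.lmarginal _
  have hgx : ∀ x, g x = ∫⁻ y, f (Function.update x i y) ∂φ := fun x => by
    simp [g, lmarginal_singleton]
  have hfg : ∫⁻ x, f x ∂(Measure.pi fun _ : ι => φ) = ∫⁻ x, g x ∂(Measure.pi fun _ : ι => φ) := by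
    refine lintegral_eq_of_lmarginal_eq {i} hf hg ?_
    ext x
    rw [lmarginal_singleton]
    rw [lmarginal_singleton]
    simp [hgx]
  have hg0 : ∫⁻ x, g x ∂(Measure.pi fun _ : ι => φ) = 0 := by
    rw [lintegral_eq_zero_iff hg]
    filter_upwards [h] with x hx
    rw [hgx]
    refine (lintegral_congr_ae ?_).trans lintegral_zero
    filter_upwards [hx] with y hy
    simp [f, hy]
  rw [← lintegral_indicator_one hA]
  exact hfg.trans hg0

variable {d : ℕ}

/-- Independent random vectors in general position: almost surely, any `d` of the random lines
`range (T x)` are linearly independent, if no nonzero vector is orthogonal to such a line with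
positive probability. -/
lemma ae_exists_linearIndepOn {ι X : Type*} [Fintype ι] [TopologicalSpace X]
    [SecondCountableTopology X] [MeasurableSpace X] [BorelSpace X] (φ : Measure X)
    [IsProbabilityMeasure φ] {T : X → Euc d →L[ℝ] Euc d} (hT : Continuous T)
    (h : ∀ v ≠ 0, ∀ᵐ x ∂φ, ∃ w, ⟪T x w, v⟫ ≠ 0) (J : Finset ι) (hJ : J.card ≤ d) :
    ∀ᵐ x ∂(Measure.pi fun _ : ι => φ),
      ∃ z : ι → Euc d, LinearIndepOn ℝ (fun i => T (x i) (z i)) (J : Set ι) := by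
  classical
  induction J using Finset.induction_on with
  | empty => simp
  | insert i J hi ih =>
    rw [Finset.card_insert_of_notMem hi] at hJ
    -- With `z` existentially quantified the event is a union of open sets, so no measurable choice
    -- of `z` is needed.
    let B : Set (ι → X) :=
      {x | ∃ z : ι → Euc d, LinearIndepOn ℝ (fun j => T (x j) (z j)) (insert i J : Set ι)}
    have hB : IsOpen B := by
      have : B = ⋃ z : ι → Euc d, (fun (x : ι → X) (j : (insert i J : Set ι)) => T (x j) (z j)) ⁻¹'
          {f | LinearIndependent ℝ f} := by
        ext x; simp [B, LinearIndepOn]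
      rw [this]
      exact isOpen_iUnion fun z => isOpen_setOfPred_linearIndependent.preimage (by fun_prop)
    have hB0 : Measure.pi (fun _ : ι => φ) Bᶜ = 0 := by
      refine measure_pi_eq_zero_of_update φ hB.measurableSet.compl i ?_
      filter_upwards [ih (by omega)] with x ⟨z, hz⟩
      let S : Submodule ℝ (Euc d) := Submodule.span ℝ ((fun j => T (x j) (z j)) '' J)
      have hS : S ≠ ⊤ := by
        intro hS
        have h1 : Module.finrank ℝ S ≤ J.card := by
          have := finrank_span_finset_le_card (R := ℝ) (J.image fun j => T (x j) (z j))
          rw [Finset.coe_image] at this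
          exact this.trans Finset.card_image_le
        rw [hS, finrank_top, finrank_euclideanSpace_fin] at h1
        omega
      -- The earlier vectors span a proper subspace; a new vector not orthogonal to some `v ⟂ S`
      -- lies outside it.
      obtain ⟨v, hvS, hv0⟩ := Sᗮ.exists_mem_ne_zero_of_ne_bot
        (fun h => hS (Submodule.orthogonal_eq_bot_iff.1 h))
      filter_upwards [h v hv0] with y ⟨w, hw⟩
      rw [Set.mem_compl_iff, not_not]
      refine ⟨Function.update z i w, ?_⟩
      have heq : Set.EqOn (fun j => T (Function.update x i y j) (Function.update z i w j))
          (fun j => T (x j) (z j)) J := by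
        intro j hj
        have : j ≠ i := fun h => hi (h ▸ hj)
        simp [this]
      rw [linearIndepOn_insert (by simpa using hi), linearIndepOn_congr heq, heq.image_eq]
      refine ⟨hz, fun hmem => hw ?_⟩
      simp only [Function.update_self] at hmem
      exact (Submodule.mem_orthogonal _ _).1 hvS _ hmem
    rw [Finset.coe_insert]
    exact (measure_eq_zero_iff_ae_notMem.1 hB0).mono fun x hx => not_not.1 hx

/-- Vectors of `ℝ^d` are in general position if any `d` of them are linearly independent. -/
def VectorsInGeneralPosition {ι : Type*} (x : ι → Euc d) : Prop :=
  ∀ J : Finset ι, J.card ≤ d → LinearIndepOn ℝ x (J : Set ι)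

/-- The functionals on a subspace `L` given by the inner products with given vectors. -/
def innerFunctional {ι : Type*} (x : ι → Euc d) (L : Submodule ℝ (Euc d)) (i : ι) :
    Module.Dual ℝ L := (innerₗ (Euc d) (x i)).domRestrict L

@[simp] lemma innerFunctional_apply {ι : Type*} (x : ι → Euc d) (L : Submodule ℝ (Euc d)) (i : ι)
    (y : L) : innerFunctional x L i y = ⟪x i, (y : Euc d)⟫ := rfl

/-- A combination of the `x i` that vanishes on `L` lies in `Lᗮ`, so only transversality of the
spans to `Lᗮ` is needed. -/
lemma VectorsInGeneralPosition.innerFunctional {ι : Type*} {x : ι → Euc d}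
    (hx : VectorsInGeneralPosition x) {L : Submodule ℝ (Euc d)}
    (hL : ∀ J : Finset ι, J.card ≤ Module.finrank ℝ L →
      Submodule.span ℝ (x '' (J : Set ι)) ⊓ Lᗮ = ⊥) :
    InGeneralPosition (innerFunctional x L) := by
  intro J hJ
  have h := hx J (hJ.trans ((Submodule.finrank_le L).trans_eq finrank_euclideanSpace_fin))
  rw [linearIndepOn_finset_iff] at h ⊢
  intro c hc
  refine h c ?_
  have hmem : ∑ i ∈ J, c i • x i ∈ Submodule.span ℝ (x '' (J : Set ι)) ⊓ Lᗮ := by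
    refine ⟨Submodule.sum_mem _ fun i hi =>
      Submodule.smul_mem _ _ (Submodule.subset_span ⟨i, hi, rfl⟩), ?_⟩
    refine (Submodule.mem_orthogonal' _ _).2 fun y hy => ?_
    have := LinearMap.congr_fun hc ⟨y, hy⟩
    simpa [sum_inner, inner_smul_left] using this
  simpa [hL J hJ] using hmem

lemma finrank_span_image_finset_le {ι : Type*} (x : ι → Euc d) (J : Finset ι) :
    Module.finrank ℝ (Submodule.span ℝ (x '' (J : Set ι))) ≤ J.card := by
  classical
  have := finrank_span_finset_le_card (R := ℝ) (J.image x)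
  rw [Finset.coe_image] at this
  exact this.trans Finset.card_image_le

lemma VectorsInGeneralPosition.innerFunctional_top {ι : Type*} {x : ι → Euc d}
    (hx : VectorsInGeneralPosition x) : InGeneralPosition (_root_.innerFunctional x ⊤) :=
  hx.innerFunctional fun J _ => by simp

lemma VectorsInGeneralPosition.ae_innerFunctional {ι : Type*} [Finite ι] {x : ι → Euc d}
    (hx : VectorsInGeneralPosition x) {j : ℕ} (hj : j ≤ d) :
    ∀ᵐ L ∂(grassmannHaar hj), InGeneralPosition (_root_.innerFunctional x L.toSubmodule) := by
  have : ∀ᵐ L ∂(grassmannHaar hj), ∀ J : Finset ι, J.card ≤ j →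
      Submodule.span ℝ (x '' (J : Set ι)) ⊓ L.toSubmoduleᗮ = ⊥ := by
    rw [ae_all_iff]
    intro J
    by_cases hJ : J.card ≤ j
    · filter_upwards [Grassmann.ae_inf_orthogonal_eq_bot hj
        ((finrank_span_image_finset_le x J).trans hJ)] with L hL _ using hL
    · exact Filter.Eventually.of_forall fun _ h => absurd h hJ
  filter_upwards [this] with L hL
  exact hx.innerFunctional fun J hJ => hL J (by rwa [L.finrank_toSubmodule] at hJ)

lemma VectorsInGeneralPosition.ae_innerFunctional_orthogonal {ι : Type*} [Finite ι]
    {x : ι → Euc d} (hx : VectorsInGeneralPosition x) {j : ℕ} (hj : j ≤ d) :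
    ∀ᵐ L ∂(grassmannHaar hj), InGeneralPosition (_root_.innerFunctional x L.toSubmoduleᗮ) := by
  have : ∀ᵐ L ∂(grassmannHaar hj), ∀ J : Finset ι, J.card ≤ d - j →
      Submodule.span ℝ (x '' (J : Set ι)) ⊓ L.toSubmodule = ⊥ := by
    rw [ae_all_iff]
    intro J
    by_cases hJ : J.card ≤ d - j
    · filter_upwards [Grassmann.ae_inf_eq_bot hj (W := Submodule.span ℝ (x '' (J : Set ι)))
        (by have := finrank_span_image_finset_le x J; omega)] with L hL _ using hL
    · exact Filter.Eventually.of_forall fun _ h => absurd h hJ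
  filter_upwards [this] with L hL
  refine hx.innerFunctional fun J hJ => ?_
  rw [Submodule.orthogonal_orthogonal]
  exact hL J (by rwa [L.finrank_orthogonal] at hJ)

lemma ae_vectorsInGeneralPosition {n : ℕ} (φ : Measure (Metric.sphere (0 : Euc d) 1))
    [IsProbabilityMeasure φ]
    (h : ∀ W : Submodule ℝ (Euc d), Module.finrank ℝ W = d - 1 → φ {x | (x : Euc d) ∈ W} = 0) :
    ∀ᵐ x ∂(Measure.pi fun _ : Fin n => φ),
      VectorsInGeneralPosition fun i => (x i : Euc d) := by
  unfold VectorsInGeneralPosition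
  rw [ae_all_iff]
  intro J
  by_cases hJ : J.card ≤ d
  swap
  · exact Filter.Eventually.of_forall fun _ h => absurd h hJ
  -- Projection onto the line of `x`.
  let T : Metric.sphere (0 : Euc d) 1 → Euc d →L[ℝ] Euc d := fun x =>
    (innerSL ℝ (x : Euc d)).smulRight (x : Euc d)
  have hT : Continuous T := by fun_prop
  have hv : ∀ v ≠ 0, ∀ᵐ x ∂φ, ∃ w, ⟪T x w, v⟫ ≠ 0 := by
    intro v hv
    have hd : Module.finrank ℝ (ℝ ∙ v)ᗮ = d - 1 := by
      have := (ℝ ∙ v).finrank_add_finrank_orthogonal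
      rw [finrank_span_singleton hv, finrank_euclideanSpace_fin] at this
      omega
    filter_upwards [measure_eq_zero_iff_ae_notMem.1 (h _ hd)] with x hx
    have hxv : ⟪(x : Euc d), v⟫ ≠ 0 := fun h0 =>
      hx (Submodule.mem_orthogonal_singleton_iff_inner_left.2 h0)
    refine ⟨x, ?_⟩
    simpa [T, inner_smul_left] using hxv
  filter_upwards [ae_exists_linearIndepOn φ hT hv J hJ] with x ⟨z, hz⟩ _
  rw [linearIndepOn_finset_iff] at hz ⊢
  intro c hc i hi
  have hzi : ∀ i ∈ J, ⟪(x i : Euc d), z i⟫ ≠ 0 := by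
    intro i hi h0
    have h1 := hz (Pi.single i 1) (by
      rw [Finset.sum_eq_single_of_mem i hi fun j _ hj => by simp [hj]]
      simp [T, h0]) i hi
    simp at h1
  have h1 := hz (fun i => c i * ⟪(x i : Euc d), z i⟫⁻¹) (by
    refine Eq.trans (Finset.sum_congr rfl fun i hi => ?_) hc
    simp [T, smul_smul, hzi i hi]) i hi
  simpa [hzi i hi] using h1

lemma ae_normalsInGeneralPosition {n : ℕ} (φs : Measure (Grassmann d (d - 1)))
    [IsProbabilityMeasure φs] (h : ∀ v : Euc d, v ≠ 0 → φs {H | v ∈ H.toSubmodule} = 0) :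
    ∀ᵐ H ∂(Measure.pi fun _ : Fin n => φs), ∀ x : Fin n → Euc d,
      (∀ i, (ℝ ∙ x i)ᗮ = (H i).toSubmodule) → VectorsInGeneralPosition x := by
  have : SecondCountableTopology (Grassmann d (d - 1)) :=
    TopologicalSpace.secondCountableTopology_induced _ _ _
  -- Projection onto the normal line, which depends continuously on `H`, unlike a choice of normal
  -- vector.
  let T : Grassmann d (d - 1) → Euc d →L[ℝ] Euc d := fun H =>
    ContinuousLinearMap.id ℝ _ - H.toSubmodule.starProjection
  have hT : Continuous T := continuous_const.sub Grassmann.continuous_starProjection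
  have hv : ∀ v ≠ 0, ∀ᵐ H ∂φs, ∃ w, ⟪T H w, v⟫ ≠ 0 := by
    intro v hv
    filter_upwards [measure_eq_zero_iff_ae_notMem.1 (h v hv)] with H hH
    by_contra! hc
    apply hH
    have h1 : ⟪v - H.toSubmodule.starProjection v, v⟫ = 0 := hc v
    have h2 : ⟪v - H.toSubmodule.starProjection v, H.toSubmodule.starProjection v⟫ = 0 :=
      Submodule.starProjection_inner_eq_zero _ _ (Submodule.starProjection_apply_mem _ _)
    have h3 : ⟪v - H.toSubmodule.starProjection v, v - H.toSubmodule.starProjection v⟫ = 0 := by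
      rw [inner_sub_right, h1, h2, sub_zero]
    exact Submodule.starProjection_eq_self_iff.1 (sub_eq_zero.1 (inner_self_eq_zero.1 h3)).symm
  have hall : ∀ᵐ H ∂(Measure.pi fun _ : Fin n => φs), ∀ J : Finset (Fin n), J.card ≤ d →
      ∃ z : Fin n → Euc d, LinearIndepOn ℝ (fun i => T (H i) (z i)) (J : Set (Fin n)) := by
    rw [ae_all_iff]
    intro J
    by_cases hJ : J.card ≤ d
    · filter_upwards [ae_exists_linearIndepOn φs hT hv J hJ] with x hx _ using hx
    · exact Filter.Eventually.of_forall fun _ h => absurd h hJ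
  filter_upwards [hall] with H hH x hx J hJ
  obtain ⟨z, hz⟩ := hH J hJ
  have hex : ∀ i, ∃ a : ℝ, a • x i = T (H i) (z i) := by
    intro i
    rw [← Submodule.mem_span_singleton, ← Submodule.orthogonal_orthogonal (ℝ ∙ x i), hx i]
    exact Submodule.sub_starProjection_mem_orthogonal _
  choose a ha using hex
  rw [linearIndepOn_finset_iff] at hz ⊢
  intro c hc i hi
  have ha0 : ∀ i ∈ J, a i ≠ 0 := by
    intro i hi h0
    have h1 := hz (Pi.single i 1) (by
      rw [Finset.sum_eq_single_of_mem i hi fun j _ hj => by simp [hj]]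
      simp [← ha, h0]) i hi
    simp at h1
  have h1 := hz (fun i => c i * (a i)⁻¹) (by
    rw [← hc]
    refine Finset.sum_congr rfl fun i hi => ?_
    rw [← ha, smul_smul, mul_assoc, inv_mul_cancel₀ (ha0 i hi), mul_one]) i hi
  simpa [ha0 i hi] using h1

end RandomVectors

/-! ### Cones and their sections by subspaces -/

section ConeSections

variable {d : ℕ} {ι : Type*}

/-- Some point of the subspace `L` has positive inner product with all given vectors. -/
def StrictlyPositiveOn (v : ι → Euc d) (L : Submodule ℝ (Euc d)) : Prop :=
  ∃ y ∈ L, ∀ i, 0 < ⟪v i, y⟫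

lemma StrictlyPositiveOn.mono {v : ι → Euc d} {L M : Submodule ℝ (Euc d)} (hLM : L ≤ M)
    (h : StrictlyPositiveOn v L) : StrictlyPositiveOn v M :=
  let ⟨y, hy, hv⟩ := h
  ⟨y, hLM hy, hv⟩

lemma signFeasible_innerFunctional_iff {v : ι → Euc d} {L : Submodule ℝ (Euc d)}
    {ε : ι → ℤˣ} :
    SignFeasible (innerFunctional v L) ε ↔
      StrictlyPositiveOn (fun i => ((ε i : ℤ) : ℝ) • v i) L := by
  simp [SignFeasible, StrictlyPositiveOn, inner_smul_left]

lemma signFeasible_innerFunctional_one_iff {v : ι → Euc d} {L : Submodule ℝ (Euc d)} :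
    SignFeasible (innerFunctional v L) 1 ↔ StrictlyPositiveOn v L := by
  simp [signFeasible_innerFunctional_iff]

lemma isOpen_setOf_strictlyPositiveOn [Finite ι] {j : ℕ} :
    IsOpen {p : (ι → Euc d) × Grassmann d j | StrictlyPositiveOn p.1 p.2.toSubmodule} := by
  have : {p : (ι → Euc d) × Grassmann d j | StrictlyPositiveOn p.1 p.2.toSubmodule} =
      ⋃ z : Euc d, ⋂ i, {p | 0 < ⟪p.1 i, p.2.toSubmodule.starProjection z⟫} := by
    ext p
    simp only [Set.mem_iUnion, Set.mem_iInter, Set.mem_ofPred_eq]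
    constructor
    · rintro ⟨y, hy, h⟩
      exact ⟨y, by rwa [Submodule.starProjection_eq_self_iff.2 hy]⟩
    · rintro ⟨z, hz⟩
      exact ⟨_, Submodule.starProjection_apply_mem _ z, hz⟩
  rw [this]
  refine isOpen_iUnion fun z => isOpen_iInter_of_finite fun i => isOpen_lt continuous_const ?_
  exact ((continuous_apply i).comp continuous_fst).inner
    ((Grassmann.continuous_starProjection.comp continuous_snd).clm_apply continuous_const)

lemma isOpen_setOf_strictlyPositiveOn_orthogonal [Finite ι] {j : ℕ} :
    IsOpen {p : (ι → Euc d) × Grassmann d j | StrictlyPositiveOn p.1 p.2.toSubmoduleᗮ} := by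
  have : {p : (ι → Euc d) × Grassmann d j | StrictlyPositiveOn p.1 p.2.toSubmoduleᗮ} =
      ⋃ z : Euc d, ⋂ i, {p | 0 < ⟪p.1 i, z - p.2.toSubmodule.starProjection z⟫} := by
    ext p
    simp only [Set.mem_iUnion, Set.mem_iInter, Set.mem_ofPred_eq]
    constructor
    · rintro ⟨y, hy, h⟩
      refine ⟨y, ?_⟩
      rwa [(Submodule.starProjection_apply_eq_zero_iff _).2 hy, sub_zero]
    · rintro ⟨z, hz⟩
      exact ⟨_, Submodule.sub_starProjection_mem_orthogonal z, hz⟩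
  rw [this]
  refine isOpen_iUnion fun z => isOpen_iInter_of_finite fun i => isOpen_lt continuous_const ?_
  exact ((continuous_apply i).comp continuous_fst).inner
    (continuous_const.sub
      ((Grassmann.continuous_starProjection.comp continuous_snd).clm_apply continuous_const))

lemma isOpen_setOf_strictlyPositiveOn_top [Finite ι] :
    IsOpen {x : ι → Euc d | StrictlyPositiveOn x ⊤} := by
  have : {x : ι → Euc d | StrictlyPositiveOn x ⊤} = ⋃ z : Euc d, ⋂ i, {x | 0 < ⟪x i, z⟫} := by
    ext p
    simp [StrictlyPositiveOn]
  rw [this]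
  refine isOpen_iUnion fun z => isOpen_iInter_of_finite fun i => isOpen_lt continuous_const ?_
  exact (continuous_apply i).inner continuous_const

lemma inter_sphere_inter_eq (C : PointedCone ℝ (Euc d)) (L : Submodule ℝ (Euc d)) :
    (C : Set (Euc d)) ∩ Metric.sphere 0 1 ∩ (L : Set (Euc d)) =
      ((C ⊓ PointedCone.ofSubmodule L : PointedCone ℝ (Euc d)) : Set (Euc d)) ∩
        Metric.sphere 0 1 := by
  rw [Set.inter_right_comm]
  rfl

lemma contractibleSpace_section {C : PointedCone ℝ (Euc d)} {L : Submodule ℝ (Euc d)} {p : Euc d}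
    (hpC : p ∈ C) (hpL : p ∈ L) (hp : p ≠ 0) (hpn : -p ∉ C) :
    ContractibleSpace ((C : Set (Euc d)) ∩ Metric.sphere 0 1 ∩ (L : Set (Euc d)) :
      Set (Euc d)) := by
  rw [inter_sphere_inter_eq]
  have hn : 0 < ‖p‖ := norm_pos_iff.2 hp
  refine contractibleSpace_cone_inter_sphere _ (p := ‖p‖⁻¹ • p)
    ⟨C.smul_mem (by positivity) hpC, L.smul_mem _ hpL⟩ (by simp [norm_smul, hp]) fun h => hpn ?_
  have := C.smul_mem hn.le h.1
  rwa [smul_neg, smul_smul, mul_inv_cancel₀ hn.ne', one_smul] at this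

-- A strictly positive `y` puts `-y`, but not `y`, in the cone, which makes the section
-- contractible. Conversely a point of the section gives a weak solution, made strict by general
-- position. With no vectors at all the section would be a whole sphere, hence `Nonempty ι`.
open Classical in
lemma eulerChar_section_of_generalPosition [Finite ι] [Nonempty ι] {v : ι → Euc d}
    {C : PointedCone ℝ (Euc d)} (hC : (C : Set (Euc d)) = {y | ∀ i, ⟪y, v i⟫ ≤ 0})
    {L : Submodule ℝ (Euc d)} (hL : InGeneralPosition (innerFunctional v L)) :
    eulerChar ((C : Set (Euc d)) ∩ Metric.sphere 0 1 ∩ (L : Set (Euc d))) =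
      if StrictlyPositiveOn v L then 1 else 0 := by
  have hC' : ∀ y, y ∈ C ↔ ∀ i, ⟪y, v i⟫ ≤ 0 := fun y => by
    rw [← SetLike.mem_coe, hC]; rfl
  split_ifs with h
  · obtain ⟨y, hyL, hy⟩ := h
    have i₀ : ι := Classical.arbitrary ι
    have := contractibleSpace_section (C := C) (L := L) (p := -y)
      ((hC' _).2 fun i => by
        rw [inner_neg_left, real_inner_comm]; exact (neg_neg_of_pos (hy i)).le)
      (L.neg_mem hyL) (by
        rw [neg_ne_zero]; rintro rfl
        simpa using hy i₀) (fun hn => by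
          have := (hC' _).1 hn i₀
          rw [neg_neg, real_inner_comm] at this
          exact this.not_gt (hy i₀))
    exact eulerChar_of_contractibleSpace _
  · convert eulerChar_empty (d := d)
    rw [Set.eq_empty_iff_forall_notMem]
    rintro y ⟨⟨hyC, hy⟩, hyL⟩
    refine h (signFeasible_innerFunctional_one_iff.1
      (hL.signFeasible_of_weak (ε := 1) (y := ⟨-y, L.neg_mem hyL⟩) ?_ fun i => ?_))
    · intro h0
      have : -y = 0 := congrArg Subtype.val h0
      rw [neg_eq_zero] at this
      rw [this] at hy
      simp at hy
    · have := (hC' _).1 hyC i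
      rw [real_inner_comm] at this
      simpa using this

lemma exists_nonneg_coeff_of_mem_hull [Fintype ι] {v : ι → Euc d} {p : Euc d}
    (hp : p ∈ PointedCone.hull ℝ (Set.range v)) :
    ∃ c : ι → ℝ, (∀ i, 0 ≤ c i) ∧ p = ∑ i, c i • v i := by
  obtain ⟨c, hc⟩ := (Submodule.mem_span_range_iff_exists_fun _).1 hp
  exact ⟨fun i => c i, fun i => (c i).2, hc.symm⟩

lemma sum_smul_mem_hull [Fintype ι] {v : ι → Euc d} {c : ι → ℝ} (hc : ∀ i, 0 ≤ c i)
    (s : Finset ι) : ∑ i ∈ s, c i • v i ∈ PointedCone.hull ℝ (Set.range v) :=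
  Submodule.sum_mem _ fun i _ =>
    PointedCone.smul_mem _ (hc i) (Submodule.subset_span ⟨i, rfl⟩)

lemma inner_nonneg_of_mem_hull [Fintype ι] {v : ι → Euc d} {p y : Euc d}
    (hp : p ∈ PointedCone.hull ℝ (Set.range v)) (hy : ∀ i, 0 ≤ ⟪v i, y⟫) : 0 ≤ ⟪p, y⟫ := by
  obtain ⟨c, hc, rfl⟩ := exists_nonneg_coeff_of_mem_hull hp
  simp only [sum_inner, inner_smul_left]
  exact Finset.sum_nonneg fun i _ => mul_nonneg (hc i) (hy i)

-- Valid for every `L`. A strictly positive `y ∈ Lᗮ` is orthogonal to any hull point in `L`, killing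
-- all its coefficients. Without such `y`, Gordan's alternative on `Lᗮ` yields a nonnegative
-- combination in `Lᗮᗮ = L`, nonzero because the vectors lie in an open halfspace.
open Classical in
lemma eulerChar_section_hull [Fintype ι] {v : ι → Euc d} (hv : StrictlyPositiveOn v ⊤)
    (L : Submodule ℝ (Euc d)) :
    eulerChar ((PointedCone.hull ℝ (Set.range v) : Set (Euc d)) ∩ Metric.sphere 0 1 ∩
      (L : Set (Euc d))) = if StrictlyPositiveOn v Lᗮ then 0 else 1 := by
  split_ifs with h
  · obtain ⟨y, hyL, hy⟩ := h
    convert eulerChar_empty (d := d)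
    rw [Set.eq_empty_iff_forall_notMem]
    rintro p ⟨⟨hpC, hp⟩, hpL⟩
    obtain ⟨c, hc, rfl⟩ := exists_nonneg_coeff_of_mem_hull hpC
    have h0 : ∑ i, c i * ⟪v i, y⟫ = 0 := by
      have := (Submodule.mem_orthogonal _ _).1 hyL _ hpL
      simpa [sum_inner, inner_smul_left] using this
    rw [Finset.sum_eq_zero_iff_of_nonneg fun i _ => mul_nonneg (hc i) (hy i).le] at h0
    have hc0 : ∀ i, c i = 0 := fun i =>
      (mul_eq_zero.1 (h0 i (Finset.mem_univ i))).resolve_right (hy i).ne'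
    simp [hc0] at hp
  · obtain ⟨y, -, hy⟩ := hv
    obtain ⟨c, hc, hc0, hsum⟩ := exists_nonneg_sum_eq_zero_of_not_signFeasible
      (mt signFeasible_innerFunctional_one_iff.1 h)
    have hpos : 0 < ⟪∑ i, c i • v i, y⟫ := by
      simp only [sum_inner, inner_smul_left]
      obtain ⟨i, hi⟩ := Function.ne_iff.1 hc0
      exact Finset.sum_pos' (fun i _ => mul_nonneg (hc i) (hy i).le)
        ⟨i, Finset.mem_univ i, mul_pos (lt_of_le_of_ne (hc i) (Ne.symm hi)) (hy i)⟩
    have := contractibleSpace_section (L := L) (p := ∑ i, c i • v i)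
      (sum_smul_mem_hull (v := v) hc Finset.univ) (by
        rw [← Submodule.orthogonal_orthogonal L]
        refine (Submodule.mem_orthogonal' _ _).2 fun z hz => ?_
        have := LinearMap.congr_fun hsum ⟨z, hz⟩
        simpa [sum_inner, inner_smul_left] using this) (by
        intro h0
        simp [h0] at hpos) (fun hn => by
        have := inner_nonneg_of_mem_hull hn fun i => (hy i).le
        rw [inner_neg_left] at this
        linarith)
    exact eulerChar_of_contractibleSpace _

lemma hull_ne_top_iff [Fintype ι] [Nonempty ι] {v : ι → Euc d} (hv : VectorsInGeneralPosition v) :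
    PointedCone.hull ℝ (Set.range v) ≠ ⊤ ↔ StrictlyPositiveOn v ⊤ := by
  classical
  constructor
  · contrapose!
    intro h
    obtain ⟨c, hc, hc0, hsum⟩ := exists_nonneg_sum_eq_zero_of_not_signFeasible
      (mt signFeasible_innerFunctional_one_iff.1 h)
    have hsum' : ∑ i, c i • v i = 0 := by
      refine ext_inner_right ℝ fun z => ?_
      have := LinearMap.congr_fun hsum ⟨z, trivial⟩
      simpa [sum_inner, inner_smul_left] using this
    let I : Finset ι := {i | c i ≠ 0}
    -- In general position a nontrivial relation involves more than `d` vectors. Any `d` of them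
    -- span, and the positive relation puts their negatives in the hull, so the hull is everything.
    have hI : d < I.card := by
      by_contra! hI
      have h1 := (linearIndepOn_finset_iff.1 (hv I hI)) c (by
        rw [← hsum']
        refine Finset.sum_subset (Finset.subset_univ _) fun i _ hi => ?_
        have : c i = 0 := by simpa [I] using hi
        simp [this])
      apply hc0
      ext i
      by_contra hi
      exact hi (h1 i (by simpa [I] using hi))
    obtain ⟨J, hJI, hJ⟩ := Finset.exists_subset_card_eq hI.le
    have hspan : Submodule.span ℝ (v '' (J : Set ι)) = ⊤ := by
      have hli : LinearIndependent ℝ fun i : J => v i := hv J hJ.le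
      have := hli.span_eq_top_of_card_eq_finrank' (by simp [hJ])
      rwa [Set.image_eq_range]
    have hneg : ∀ j ∈ I, -v j ∈ PointedCone.hull ℝ (Set.range v) := by
      intro j hj
      have hcj : 0 < c j := lt_of_le_of_ne (hc j) (Ne.symm (by simpa [I] using hj))
      have h1 : -(c j • v j) = ∑ i ∈ Finset.univ.erase j, c i • v i := by
        rw [← Finset.add_sum_erase _ _ (Finset.mem_univ j)] at hsum'
        exact neg_eq_of_add_eq_zero_right hsum'
      have h2 := PointedCone.smul_mem _ (inv_nonneg.2 hcj.le)
        (sum_smul_mem_hull (v := v) hc (Finset.univ.erase j))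
      rwa [← h1, smul_neg, smul_smul, inv_mul_cancel₀ hcj.ne', one_smul] at h2
    have key : ∀ p ∈ Submodule.span ℝ (v '' (J : Set ι)),
        p ∈ PointedCone.hull ℝ (Set.range v) ∧ -p ∈ PointedCone.hull ℝ (Set.range v) := by
      intro p hp
      induction hp using Submodule.span_induction with
      | mem p hp =>
        obtain ⟨j, hj, rfl⟩ := hp
        exact ⟨Submodule.subset_span ⟨j, rfl⟩, hneg j (hJI hj)⟩
      | zero => simp
      | add a b _ _ ha hb =>
        rw [neg_add]
        exact ⟨Submodule.add_mem _ ha.1 hb.1, Submodule.add_mem _ ha.2 hb.2⟩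
      | smul r a _ ha =>
        rcases le_total 0 r with hr | hr
        · rw [← smul_neg]
          exact ⟨PointedCone.smul_mem _ hr ha.1, PointedCone.smul_mem _ hr ha.2⟩
        · rw [← neg_smul, ← neg_smul_neg r a]
          exact ⟨PointedCone.smul_mem _ (neg_nonneg.2 hr) ha.2,
            PointedCone.smul_mem _ (neg_nonneg.2 hr) ha.1⟩
    rw [eq_top_iff]
    intro p _
    exact (key p (hspan ▸ Submodule.mem_top)).1
  · rintro ⟨y, -, hy⟩ htop
    have h1 : -y ∈ PointedCone.hull ℝ (Set.range v) := htop ▸ Submodule.mem_top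
    have h2 := inner_nonneg_of_mem_hull h1 fun i => (hy i).le
    have h3 : y = 0 := by
      rw [inner_neg_left, neg_nonneg] at h2
      exact inner_self_eq_zero.1 (le_antisymm h2 real_inner_self_nonneg)
    have := hy (Classical.arbitrary ι)
    simp [h3] at this

end ConeSections

/-! ### Averaging over sign patterns -/

section Averages

/-- Linearity of expectation: the probabilities add up to the expected number of events that occur.
-/
lemma sum_measureReal_eq_of_ae_ncard {Ω κ : Type*} [MeasurableSpace Ω] [Fintype κ]
    (μ : Measure Ω) [IsProbabilityMeasure μ] {A : κ → Set Ω} (hA : ∀ ε, MeasurableSet (A ε))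
    {N : ℕ} (h : ∀ᵐ ω ∂μ, {ε | ω ∈ A ε}.ncard = N) : ∑ ε, μ.real (A ε) = N := by
  classical
  have h1 : ∀ ε, μ.real (A ε) = ∫ ω, (A ε).indicator 1 ω ∂μ := fun ε =>
    (integral_indicator_one (hA ε)).symm
  simp_rw [h1]
  have hint : ∀ ε, Integrable ((A ε).indicator (1 : Ω → ℝ)) μ := fun ε =>
    (integrable_const (1 : ℝ)).indicator (hA ε)
  rw [← integral_finsetSum _ fun ε _ => hint ε]
  have h2 : ∀ᵐ ω ∂μ, ∑ ε, (A ε).indicator (1 : Ω → ℝ) ω = N := by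
    filter_upwards [h] with ω hω
    rw [← hω, Set.ncard_eq_toFinset_card']
    simp [Set.indicator_apply]
  rw [integral_congr_ae h2]
  simp

variable {d n : ℕ}

lemma sum_grassmannHaar_strictlyPositiveOn {x : Fin n → Euc d} (hx : VectorsInGeneralPosition x)
    {j : ℕ} (hj : j ≤ d) :
    ∑ ε : Fin n → ℤˣ, (grassmannHaar hj).real
      {L | StrictlyPositiveOn (fun i => ((ε i : ℤ) : ℝ) • x i) L.toSubmodule} =
      schlafliNumber n j := by
  refine sum_measureReal_eq_of_ae_ncard _ (fun ε => ?_) ?_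
  · exact (isOpen_setOf_strictlyPositiveOn.preimage
      (Continuous.prodMk_right (fun i => ((ε i : ℤ) : ℝ) • x i))).measurableSet
  · filter_upwards [hx.ae_innerFunctional hj] with L hL
    have := ncard_signFeasible n _ hL
    simp only [signFeasible_innerFunctional_iff, L.finrank_toSubmodule] at this
    exact this

lemma sum_grassmannHaar_strictlyPositiveOn_orthogonal {x : Fin n → Euc d}
    (hx : VectorsInGeneralPosition x) {j : ℕ} (hj : j ≤ d) :
    ∑ ε : Fin n → ℤˣ, (grassmannHaar hj).real
      {L | StrictlyPositiveOn (fun i => ((ε i : ℤ) : ℝ) • x i) L.toSubmoduleᗮ} =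
      schlafliNumber n (d - j) := by
  refine sum_measureReal_eq_of_ae_ncard _ (fun ε => ?_) ?_
  · exact (isOpen_setOf_strictlyPositiveOn_orthogonal.preimage
      (Continuous.prodMk_right (fun i => ((ε i : ℤ) : ℝ) • x i))).measurableSet
  · filter_upwards [hx.ae_innerFunctional_orthogonal hj] with L hL
    have := ncard_signFeasible n _ hL
    simp only [signFeasible_innerFunctional_iff, L.finrank_orthogonal] at this
    exact this

lemma ncard_strictlyPositiveOn_top {x : Fin n → Euc d} (hx : VectorsInGeneralPosition x) :
    {ε : Fin n → ℤˣ | StrictlyPositiveOn (fun i => ((ε i : ℤ) : ℝ) • x i) ⊤}.ncard =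
      schlafliNumber n d := by
  have := ncard_signFeasible n _ hx.innerFunctional_top
  simp only [signFeasible_innerFunctional_iff, finrank_top, finrank_euclideanSpace_fin] at this
  exact this

lemma conicalQuermass_of_generalPosition {ι : Type*} [Finite ι] [Nonempty ι] {v : ι → Euc d}
    (hv : VectorsInGeneralPosition v) {C : PointedCone ℝ (Euc d)}
    (hC : (C : Set (Euc d)) = {y | ∀ i, ⟪y, v i⟫ ≤ 0}) (k : ℕ) :
    conicalQuermass k C = 1 / 2 * (grassmannHaar (Nat.sub_le d k)).real
      {L | StrictlyPositiveOn v L.toSubmodule} := by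
  classical
  have hm : MeasurableSet {L : Grassmann d (d - k) | StrictlyPositiveOn v L.toSubmodule} :=
    (isOpen_setOf_strictlyPositiveOn.preimage (Continuous.prodMk_right v)).measurableSet
  rw [conicalQuermass, sphericalQuermass, ← integral_indicator_one hm]
  congr 1
  refine integral_congr_ae ?_
  filter_upwards [hv.ae_innerFunctional (Nat.sub_le d k)] with L hL
  rw [eulerChar_section_of_generalPosition hC hL, Set.indicator_apply]
  simp

lemma conicalQuermass_hull {ι : Type*} [Fintype ι] {v : ι → Euc d}
    (hv : StrictlyPositiveOn v ⊤) (k : ℕ) :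
    conicalQuermass k (PointedCone.hull ℝ (Set.range v)) =
      1 / 2 * (1 - (grassmannHaar (Nat.sub_le d k)).real
        {L | StrictlyPositiveOn v L.toSubmoduleᗮ}) := by
  classical
  have hm : MeasurableSet {L : Grassmann d (d - k) | StrictlyPositiveOn v L.toSubmoduleᗮ} :=
    (isOpen_setOf_strictlyPositiveOn_orthogonal.preimage (Continuous.prodMk_right v)).measurableSet
  rw [conicalQuermass, sphericalQuermass, ← probReal_compl_eq_one_sub hm,
    ← integral_indicator_one hm.compl]
  congr 1
  refine integral_congr_ae (Filter.Eventually.of_forall fun L => ?_)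
  simp only [eulerChar_section_hull hv, Set.indicator_apply]
  by_cases h : StrictlyPositiveOn v L.toSubmoduleᗮ <;> simp [h]

end Averages

/-! ### Schläfli cones -/

section Schlafli

variable {d n : ℕ}

/-- The cone of all points having nonpositive inner product with the given vectors. -/
def polarCone {ι : Type*} (v : ι → Euc d) : PointedCone ℝ (Euc d) where
  carrier := {y | ∀ i, ⟪y, v i⟫ ≤ 0}
  add_mem' {a b} ha hb i := by
    rw [inner_add_left]; exact add_nonpos (ha i) (hb i)
  zero_mem' i := by simp
  smul_mem' c a ha i := by
    have : c • a = (c : ℝ) • a := rfl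
    rw [this, inner_smul_left]
    exact mul_nonpos_of_nonneg_of_nonpos c.2 (ha i)

lemma coe_polarCone {ι : Type*} (v : ι → Euc d) :
    (polarCone v : Set (Euc d)) = {y | ∀ i, ⟪y, v i⟫ ≤ 0} := rfl

lemma interior_polarCone_nonempty_iff {ι : Type*} [Finite ι] (hd : 0 < d) {v : ι → Euc d}
    (hv : VectorsInGeneralPosition v) :
    (interior (polarCone v : Set (Euc d))).Nonempty ↔ StrictlyPositiveOn v ⊤ := by
  have : Nonempty (Fin d) := ⟨⟨0, hd⟩⟩
  constructor
  · intro h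
    obtain ⟨y, hy, hy0⟩ : ∃ y ∈ (polarCone v : Set (Euc d)), y ≠ 0 := by
      by_contra! hc
      have h1 : (polarCone v : Set (Euc d)) ⊆ {0} := hc
      have h2 := h.mono (interior_mono h1)
      rw [interior_singleton] at h2
      exact Set.not_nonempty_empty h2
    refine signFeasible_innerFunctional_one_iff.1
      (hv.innerFunctional_top.signFeasible_of_weak (ε := 1) (y := ⟨-y, trivial⟩) ?_ fun i => ?_)
    · intro h0
      exact hy0 (neg_eq_zero.1 (congrArg Subtype.val h0))
    · have := hy i
      rw [real_inner_comm] at this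
      simpa using this
  · rintro ⟨y, -, hy⟩
    refine ⟨-y, mem_interior.2 ⟨⋂ i, {z | ⟪z, v i⟫ < 0}, ?_, ?_, ?_⟩⟩
    · intro z hz i
      exact (Set.mem_iInter.1 hz i).le
    · exact isOpen_iInter_of_finite fun i =>
        isOpen_lt (continuous_id.inner continuous_const) continuous_const
    · refine Set.mem_iInter.2 fun i => ?_
      change ⟪-y, v i⟫ < 0
      rw [inner_neg_left, real_inner_comm]
      exact neg_neg_of_pos (hy i)

lemma VectorsInGeneralPosition.sign_smul {ι : Type*} {v : ι → Euc d}
    (h : VectorsInGeneralPosition v) (ε : ι → ℤˣ) :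
    VectorsInGeneralPosition fun i => ((ε i : ℤ) : ℝ) • v i := by
  intro J hJ
  have h := h J hJ
  rw [linearIndepOn_finset_iff] at h ⊢
  intro c hc i hi
  have := h (fun i => c i * ((ε i : ℤ) : ℝ)) (by simpa [mul_smul] using hc) i hi
  simpa using this

lemma Grassmann.exists_normal (hd : 0 < d) (H : Grassmann d (d - 1)) :
    ∃ a : Euc d, a ≠ 0 ∧ (ℝ ∙ a)ᗮ = H.toSubmodule := by
  have h1 : Module.finrank ℝ H.toSubmoduleᗮ = 1 := by
    rw [H.finrank_orthogonal]; omega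
  obtain ⟨a, ha, ha0⟩ := H.toSubmoduleᗮ.exists_mem_ne_zero_of_ne_bot (by
    intro h0; rw [h0, finrank_bot] at h1; omega)
  refine ⟨a, ha0, ?_⟩
  have h2 : (ℝ ∙ a) = H.toSubmoduleᗮ := Submodule.eq_of_le_of_finrank_eq
    ((Submodule.span_singleton_le_iff_mem _ _).2 ha) (by rw [finrank_span_singleton ha0, h1])
  rw [h2, Submodule.orthogonal_orthogonal]

/-- Normals of a hyperplane differ by a nonzero factor, of which the cone sees only the sign. -/
lemma schlafliCones_eq_image (hd : 0 < d) {H : Fin n → Grassmann d (d - 1)} {a : Fin n → Euc d}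
    (ha0 : ∀ i, a i ≠ 0) (ha : ∀ i, (ℝ ∙ a i)ᗮ = (H i).toSubmodule)
    (hv : VectorsInGeneralPosition a) :
    schlafliCones H = (fun ε : Fin n → ℤˣ => polarCone fun i => ((ε i : ℤ) : ℝ) • a i) ''
      {ε | StrictlyPositiveOn (fun i => ((ε i : ℤ) : ℝ) • a i) ⊤} := by
  ext C
  constructor
  · rintro ⟨x, hx, hC, hint⟩
    have hxa : ∀ i, ∃ r : ℝ, r ≠ 0 ∧ x i = r • a i := by
      intro i
      have h1 : (ℝ ∙ x i) = ℝ ∙ a i := by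
        rw [← Submodule.orthogonal_orthogonal (ℝ ∙ x i), hx i, ← ha i,
          Submodule.orthogonal_orthogonal]
      obtain ⟨r, hr⟩ := Submodule.mem_span_singleton.1
        (h1 ▸ Submodule.mem_span_singleton_self (x i))
      refine ⟨r, ?_, hr.symm⟩
      rintro rfl
      rw [zero_smul] at hr
      rw [← hr, Submodule.span_zero_singleton, eq_comm, Submodule.span_singleton_eq_bot] at h1
      exact ha0 i h1
    choose r hr hxr using hxa
    let ε : Fin n → ℤˣ := fun i => if 0 < r i then 1 else -1
    have hCε : polarCone (fun i => ((ε i : ℤ) : ℝ) • a i) = C := by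
      refine SetLike.coe_injective ?_
      rw [hC, coe_polarCone]
      ext y
      refine forall_congr' fun i => ?_
      rw [hxr]
      by_cases h : 0 < r i
      · simp [ε, h, inner_smul_right, mul_nonpos_iff, h.le, h.not_ge]
      · have h' : r i < 0 := lt_of_le_of_ne (not_lt.1 h) (hr i)
        simp [ε, h, inner_smul_right, mul_nonpos_iff, h'.le, h'.not_ge]
    refine ⟨ε, ?_, hCε⟩
    rw [← hCε] at hint
    exact (interior_polarCone_nonempty_iff hd (hv.sign_smul ε)).1 hint
  · rintro ⟨ε, hε, rfl⟩
    refine ⟨fun i => ((ε i : ℤ) : ℝ) • a i, fun i => ?_, rfl,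
      (interior_polarCone_nonempty_iff hd (hv.sign_smul ε)).2 hε⟩
    rw [Submodule.span_singleton_smul_eq (by simp), ha i]

/-- A point where all inequalities are strict determines every sign; hence cones can be counted by
sign vectors. -/
lemma injOn_polarCone (a : Fin n → Euc d) :
    Set.InjOn (fun ε : Fin n → ℤˣ => polarCone fun i => ((ε i : ℤ) : ℝ) • a i)
      {ε | StrictlyPositiveOn (fun i => ((ε i : ℤ) : ℝ) • a i) ⊤} := by
  rintro ε ⟨y, -, hy⟩ ε' - h
  have h1 : -y ∈ polarCone fun i => ((ε i : ℤ) : ℝ) • a i := fun i => by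
    rw [inner_neg_left, real_inner_comm]; exact (neg_neg_of_pos (hy i)).le
  have h2 : -y ∈ polarCone fun i => ((ε' i : ℤ) : ℝ) • a i := by
    have h' : (polarCone fun i => ((ε i : ℤ) : ℝ) • a i) =
      polarCone fun i => ((ε' i : ℤ) : ℝ) • a i := h
    rwa [h'] at h1
  ext1 i
  have h3 := h2 i
  have h4 := hy i
  simp only [inner_neg_left, inner_smul_right, inner_smul_left] at h3 h4
  rw [real_inner_comm] at h3
  rcases Int.units_eq_one_or (ε i) with h5 | h5 <;>
    rcases Int.units_eq_one_or (ε' i) with h6 | h6 <;> simp [h5, h6] at h3 h4 ⊢ <;> linarith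

lemma schlafliAverage_conicalQuermass [NeZero n] {k : ℕ} (hk : k < d)
    {H : Fin n → Grassmann d (d - 1)}
    (hH : ∀ x : Fin n → Euc d, (∀ i, (ℝ ∙ x i)ᗮ = (H i).toSubmodule) →
      VectorsInGeneralPosition x) :
    schlafliAverage (conicalQuermass k) H =
      (schlafliNumber n (d - k) : ℝ) / (2 * schlafliNumber n d) := by
  classical
  have hd : 0 < d := by omega
  choose a ha0 ha using fun i => Grassmann.exists_normal hd (H i)
  have hv := hH a ha
  let F : Set (Fin n → ℤˣ) := {ε | StrictlyPositiveOn (fun i => ((ε i : ℤ) : ℝ) • a i) ⊤}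
  rw [schlafliAverage, schlafliCones_eq_image hd ha0 ha hv,
    finsum_mem_image (injOn_polarCone a), (injOn_polarCone a).ncard_image,
    ncard_strictlyPositiveOn_top hv]
  have hsum : ∑ᶠ ε ∈ F, conicalQuermass k (polarCone fun i => ((ε i : ℤ) : ℝ) • a i) =
      1 / 2 * (schlafliNumber n (d - k) : ℝ) := by
    rw [finsum_mem_eq_toFinset_sum, ← sum_grassmannHaar_strictlyPositiveOn hv (Nat.sub_le d k),
      Finset.mul_sum]
    have h1 : ∀ ε ∈ F.toFinset, conicalQuermass k (polarCone fun i => ((ε i : ℤ) : ℝ) • a i) =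
        1 / 2 * (grassmannHaar (Nat.sub_le d k)).real
          {L | StrictlyPositiveOn (fun i => ((ε i : ℤ) : ℝ) • a i) L.toSubmodule} := fun ε _ =>
      conicalQuermass_of_generalPosition (hv.sign_smul ε) (coe_polarCone _) k
    rw [Finset.sum_congr rfl h1]
    -- A sign vector not realized in `ℝ^d` is realized in no `L`, so the sum extends to all sign
    -- vectors at no cost.
    refine Finset.sum_subset (Finset.subset_univ _) fun ε _ hε => ?_
    have h2 : {L : Grassmann d (d - k) |
        StrictlyPositiveOn (fun i => ((ε i : ℤ) : ℝ) • a i) L.toSubmodule} = ∅ := by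
      refine Set.eq_empty_iff_forall_notMem.2 fun L hL => hε ?_
      rw [Set.mem_toFinset]
      exact StrictlyPositiveOn.mono le_top hL
    simp [h2]
  rw [hsum]
  ring

theorem schlafliExpectation_conicalQuermass [NeZero n] {k : ℕ} (hk : k < d)
    (φs : Measure (Grassmann d (d - 1))) [IsProbabilityMeasure φs]
    (h : ∀ v : Euc d, v ≠ 0 → φs {H | v ∈ H.toSubmodule} = 0) :
    Integrable (fun H : Fin n → Grassmann d (d - 1) =>
        schlafliAverage (conicalQuermass k) H) (Measure.pi fun _ => φs) ∧
      schlafliExpectation φs n (conicalQuermass k) =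
        (schlafliNumber n (d - k) : ℝ) / (2 * schlafliNumber n d) := by
  have hae : (fun H : Fin n → Grassmann d (d - 1) => schlafliAverage (conicalQuermass k) H)
      =ᵐ[Measure.pi fun _ => φs]
        fun _ => (schlafliNumber n (d - k) : ℝ) / (2 * schlafliNumber n d) :=
    (ae_normalsInGeneralPosition φs h).mono fun H hH => schlafliAverage_conicalQuermass hk hH
  refine ⟨(integrable_const _).congr hae.symm, ?_⟩
  rw [schlafliExpectation, integral_congr_ae hae]
  simp

end Schlafli

/-! ### Cover–Efron cones -/

section CoverEfron

variable {d n : ℕ}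

/-- Changing the signs of points of the sphere. -/
def flipSigns (ε : Fin n → ℤˣ) (x : Fin n → Metric.sphere (0 : Euc d) 1) :
    Fin n → Metric.sphere (0 : Euc d) 1 :=
  fun i => if ε i = 1 then x i else -x i

lemma coe_flipSigns (ε : Fin n → ℤˣ) (x : Fin n → Metric.sphere (0 : Euc d) 1) (i : Fin n) :
    (flipSigns ε x i : Euc d) = ((ε i : ℤ) : ℝ) • (x i : Euc d) := by
  rcases Int.units_eq_one_or (ε i) with h | h <;> simp [flipSigns, h]

lemma measurePreserving_flipSigns {φ : Measure (Metric.sphere (0 : Euc d) 1)}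
    [IsProbabilityMeasure φ] (hφ : φ.map (fun x => -x) = φ) (ε : Fin n → ℤˣ) :
    MeasurePreserving (flipSigns (d := d) ε) (Measure.pi fun _ => φ) (Measure.pi fun _ => φ) := by
  have hneg : MeasurePreserving (fun x : Metric.sphere (0 : Euc d) 1 => -x) φ φ :=
    ⟨continuous_neg.measurable, hφ⟩
  refine measurePreserving_pi (f := fun i (x : Metric.sphere (0 : Euc d) 1) =>
    if ε i = 1 then x else -x) _ _ fun i => ?_
  by_cases h : ε i = 1
  · simp only [h, if_true]
    exact MeasurePreserving.id φ
  · simpa [h] using hneg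

lemma isOpen_setOf_sphere_strictlyPositiveOn_top :
    IsOpen {x : Fin n → Metric.sphere (0 : Euc d) 1 |
      StrictlyPositiveOn (fun i => (x i : Euc d)) ⊤} :=
  isOpen_setOf_strictlyPositiveOn_top.preimage
    (f := fun (x : Fin n → Metric.sphere (0 : Euc d) 1) i => (x i : Euc d)) (by fun_prop)

lemma measurable_grassmannHaar_strictlyPositiveOn_orthogonal {j : ℕ} (hj : j ≤ d) :
    Measurable fun x : Fin n → Metric.sphere (0 : Euc d) 1 => (grassmannHaar hj).real
      {L | StrictlyPositiveOn (fun i => (x i : Euc d)) L.toSubmoduleᗮ} := by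
  have : SecondCountableTopology (Grassmann d j) :=
    TopologicalSpace.secondCountableTopology_induced _ _ _
  have hopen : IsOpen {p : (Fin n → Metric.sphere (0 : Euc d) 1) × Grassmann d j |
      StrictlyPositiveOn (fun i => (p.1 i : Euc d)) p.2.toSubmoduleᗮ} :=
    isOpen_setOf_strictlyPositiveOn_orthogonal.preimage
      (f := fun p : (Fin n → Metric.sphere (0 : Euc d) 1) × Grassmann d j =>
        ((fun i => (p.1 i : Euc d)), p.2)) (by fun_prop)
  exact (measurable_measure_prodMk_left hopen.measurableSet).ennreal_toReal

variable {φ : Measure (Metric.sphere (0 : Euc d) 1)} [IsProbabilityMeasure φ]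

/-- Wendel's formula: sign flips preserve the product measure, so the `2^n` patterns are equally
likely, while the number realized is almost surely the Schläfli number. -/
lemma two_pow_mul_measure_strictlyPositiveOn_top (hφ : φ.map (fun x => -x) = φ)
    (h : ∀ W : Submodule ℝ (Euc d), Module.finrank ℝ W = d - 1 → φ {x | (x : Euc d) ∈ W} = 0) :
    2 ^ n * (Measure.pi fun _ : Fin n => φ).real
      {x | StrictlyPositiveOn (fun i => (x i : Euc d)) ⊤} = schlafliNumber n d := by
  have hopen := isOpen_setOf_sphere_strictlyPositiveOn_top (d := d) (n := n)
  have key := sum_measureReal_eq_of_ae_ncard (κ := Fin n → ℤˣ) (Measure.pi fun _ : Fin n => φ)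
    (A := fun ε => flipSigns ε ⁻¹' {x | StrictlyPositiveOn (fun i => (x i : Euc d)) ⊤})
    (fun ε => hopen.measurableSet.preimage (measurePreserving_flipSigns hφ ε).measurable)
    (N := schlafliNumber n d) (by
      filter_upwards [ae_vectorsInGeneralPosition φ h] with x hx
      have := ncard_strictlyPositiveOn_top hx
      simp only [Set.mem_preimage, Set.mem_ofPred_eq, coe_flipSigns]
      exact this)
  rw [← key]
  have : ∀ ε : Fin n → ℤˣ, (Measure.pi fun _ : Fin n => φ).real
      (flipSigns ε ⁻¹' {x | StrictlyPositiveOn (fun i => (x i : Euc d)) ⊤}) =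
      (Measure.pi fun _ : Fin n => φ).real {x | StrictlyPositiveOn (fun i => (x i : Euc d)) ⊤} :=
    fun ε => (measurePreserving_flipSigns hφ ε).measureReal_preimage
      hopen.measurableSet.nullMeasurableSet
  rw [Finset.sum_congr rfl fun ε _ => this ε]
  simp

/-- The same symmetrization, with an additional average over `L`; the regions counted lie in `Lᗮ`,
of dimension `d - j`. -/
lemma two_pow_mul_integral_strictlyPositiveOn_orthogonal (hφ : φ.map (fun x => -x) = φ)
    (h : ∀ W : Submodule ℝ (Euc d), Module.finrank ℝ W = d - 1 → φ {x | (x : Euc d) ∈ W} = 0)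
    {j : ℕ} (hj : j ≤ d) :
    2 ^ n * ∫ x : Fin n → Metric.sphere (0 : Euc d) 1, (grassmannHaar hj).real
      {L | StrictlyPositiveOn (fun i => (x i : Euc d)) L.toSubmoduleᗮ}
        ∂(Measure.pi fun _ => φ) = schlafliNumber n (d - j) := by
  let μ : Measure (Fin n → Metric.sphere (0 : Euc d) 1) := Measure.pi fun _ => φ
  let r : (Fin n → Metric.sphere (0 : Euc d) 1) → ℝ := fun x => (grassmannHaar hj).real
      {L | StrictlyPositiveOn (fun i => (x i : Euc d)) L.toSubmoduleᗮ}
  have hr : Measurable r := measurable_grassmannHaar_strictlyPositiveOn_orthogonal hj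
  have hri : Integrable r μ := Integrable.of_bound hr.aestronglyMeasurable 1
    (Filter.Eventually.of_forall fun x => by
      rw [Real.norm_of_nonneg measureReal_nonneg]; exact measureReal_le_one)
  have hflip : ∀ ε, ∫ x, r (flipSigns ε x) ∂μ = ∫ x, r x ∂μ := fun ε => by
    have hm := measurePreserving_flipSigns (n := n) hφ ε
    have := integral_map (μ := μ) hm.measurable.aemeasurable (f := r)
      hr.stronglyMeasurable.aestronglyMeasurable
    rw [hm.map_eq] at this
    exact this.symm
  have hint : ∀ ε, Integrable (fun x => r (flipSigns ε x)) μ := fun ε =>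
    (measurePreserving_flipSigns hφ ε).integrable_comp_of_integrable hri
  have h1 : ∑ ε : Fin n → ℤˣ, ∫ x, r (flipSigns ε x) ∂μ = schlafliNumber n (d - j) := by
    rw [← integral_finsetSum _ fun ε _ => hint ε]
    have hae : ∀ᵐ x ∂μ, ∑ ε : Fin n → ℤˣ, r (flipSigns ε x) = schlafliNumber n (d - j) := by
      filter_upwards [ae_vectorsInGeneralPosition φ h] with x hx
      rw [← sum_grassmannHaar_strictlyPositiveOn_orthogonal hx hj]
      simp only [r, coe_flipSigns]
    rw [integral_congr_ae hae]
    simp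
  rw [← h1]
  simp [hflip, r, μ]

lemma coverEfronMeasure_eq_cond [NeZero n]
    (h : ∀ W : Submodule ℝ (Euc d), Module.finrank ℝ W = d - 1 → φ {x | (x : Euc d) ∈ W} = 0) :
    coverEfronMeasure φ n = ProbabilityTheory.cond (Measure.pi fun _ : Fin n => φ)
      {x | StrictlyPositiveOn (fun i => (x i : Euc d)) ⊤} := by
  have hae : {x : Fin n → Metric.sphere (0 : Euc d) 1 | posHull x ≠ ⊤}
      =ᵐ[Measure.pi fun _ : Fin n => φ]
        {x | StrictlyPositiveOn (fun i => (x i : Euc d)) ⊤} := by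
    filter_upwards [ae_vectorsInGeneralPosition φ h] with x hx
    exact propext (hull_ne_top_iff hx)
  rw [coverEfronMeasure, ProbabilityTheory.cond, ProbabilityTheory.cond, measure_congr hae,
    Measure.restrict_congr_set hae]

theorem coverEfronExpectation_conicalQuermass [NeZero n] (hφ : φ.map (fun x => -x) = φ)
    (h : ∀ W : Submodule ℝ (Euc d), Module.finrank ℝ W = d - 1 → φ {x | (x : Euc d) ∈ W} = 0)
    {k : ℕ} (hk : k < d) :
    IsProbabilityMeasure (coverEfronMeasure φ n) ∧
      Integrable (fun x => conicalQuermass k (posHull x)) (coverEfronMeasure φ n) ∧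
      coverEfronExpectation φ n (conicalQuermass k) =
        ((schlafliNumber n d : ℝ) - schlafliNumber n k) / (2 * schlafliNumber n d) := by
  let μ : Measure (Fin n → Metric.sphere (0 : Euc d) 1) := Measure.pi fun _ => φ
  let F : Set (Fin n → Metric.sphere (0 : Euc d) 1) :=
    {x | StrictlyPositiveOn (fun i => (x i : Euc d)) ⊤}
  have hF : MeasurableSet F := isOpen_setOf_sphere_strictlyPositiveOn_top.measurableSet
  let r : (Fin n → Metric.sphere (0 : Euc d) 1) → ℝ := fun x =>
    (grassmannHaar (Nat.sub_le d k)).real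
      {L | StrictlyPositiveOn (fun i => (x i : Euc d)) L.toSubmoduleᗮ}
  have hr : Measurable r := measurable_grassmannHaar_strictlyPositiveOn_orthogonal _
  have hri : Integrable r μ := Integrable.of_bound hr.aestronglyMeasurable 1
    (Filter.Eventually.of_forall fun x => by
      rw [Real.norm_of_nonneg measureReal_nonneg]; exact measureReal_le_one)
  -- Positivity on some `Lᗮ` implies positivity on `ℝ^d`, so the integral of `r` over the
  -- conditioning event is its full integral.
  have hrF : ∀ x ∉ F, r x = 0 := by
    intro x hx
    have h2 : {L : Grassmann d (d - k) |
        StrictlyPositiveOn (fun i => (x i : Euc d)) L.toSubmoduleᗮ} = ∅ :=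
      Set.eq_empty_iff_forall_notMem.2 fun L hL => hx (StrictlyPositiveOn.mono le_top hL)
    simp [r, h2]
  have hN : (0 : ℝ) < schlafliNumber n d := by
    exact_mod_cast schlafliNumber_pos (by omega)
  have hμF : 2 ^ n * μ.real F = schlafliNumber n d :=
    two_pow_mul_measure_strictlyPositiveOn_top hφ h
  have hμr : 2 ^ n * ∫ x, r x ∂μ = schlafliNumber n k := by
    have := two_pow_mul_integral_strictlyPositiveOn_orthogonal (n := n) hφ h (Nat.sub_le d k)
    -- Here `L` has dimension `d - k`, so `Lᗮ` has dimension `k`.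
    rwa [Nat.sub_sub_self hk.le] at this
  have hμF0 : μ F ≠ 0 := by
    intro h0
    rw [measureReal_def, h0, ENNReal.toReal_zero, mul_zero] at hμF
    exact hN.ne hμF
  have hq : Set.EqOn (fun x => conicalQuermass k (posHull x)) (fun x => 1 / 2 * (1 - r x)) F :=
    fun x hx => conicalQuermass_hull hx k
  have hint : IntegrableOn (fun x => conicalQuermass k (posHull x)) F μ := by
    refine IntegrableOn.congr_fun ?_ hq.symm hF
    exact (((integrable_const 1).sub hri).const_mul _).integrableOn
  rw [coverEfronExpectation, coverEfronMeasure_eq_cond h]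
  refine ⟨cond_isProbabilityMeasure hμF0, ?_, ?_⟩
  · exact Integrable.smul_measure hint (ENNReal.inv_ne_top.2 hμF0)
  · change ∫ x, conicalQuermass k (posHull x) ∂((μ F)⁻¹ • μ.restrict F) = _
    rw [integral_smul_measure, setIntegral_congr_fun hF hq, integral_const_mul,
      integral_sub (integrable_const _) hri.integrableOn,
      setIntegral_eq_integral_of_forall_compl_eq_zero hrF, ENNReal.toReal_inv]
    have hμF' : 0 < μ.real F := (mul_pos_iff_of_pos_left (by positivity)).1 (hμF.symm ▸ hN)
    have h2 : (2 : ℝ) ^ n ≠ 0 := by positivity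
    rw [← hμF, ← hμr]
    simp only [integral_const, measureReal_restrict_apply_univ, smul_eq_mul, mul_one]
    rw [← measureReal_def]
    field_simp

end CoverEfron

end

theorem mainTheorem4 (d n : ℕ) (hn : 1 ≤ n) :
    (∀ φs : MeasureTheory.Measure (Grassmann d (d - 1)),
      MeasureTheory.IsProbabilityMeasure φs →
      (∀ v : Euc d, v ≠ 0 → φs {H | v ∈ H.toSubmodule} = 0) →
      ∀ k < d,
        MeasureTheory.Integrable (fun H : Fin n → Grassmann d (d - 1) =>
          schlafliAverage (conicalQuermass k) H) (MeasureTheory.Measure.pi fun _ => φs) ∧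
        schlafliExpectation φs n (conicalQuermass k) =
          (schlafliNumber n (d - k) : ℝ) / (2 * schlafliNumber n d)) ∧
    (∀ φ : MeasureTheory.Measure (Metric.sphere (0 : Euc d) 1),
      MeasureTheory.IsProbabilityMeasure φ →
      φ.map (fun x => -x) = φ →
      (∀ W : Submodule ℝ (Euc d), Module.finrank ℝ W = d - 1 →
        φ {x | (x : Euc d) ∈ W} = 0) →
      ∀ k, 1 ≤ k → k < d →
        MeasureTheory.IsProbabilityMeasure (coverEfronMeasure φ n) ∧
        MeasureTheory.Integrable (fun x => conicalQuermass k (posHull x))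
          (coverEfronMeasure φ n) ∧
        coverEfronExpectation φ n (conicalQuermass k) =
          ((schlafliNumber n d : ℝ) - schlafliNumber n k) / (2 * schlafliNumber n d)) := by
  have : NeZero n := ⟨by omega⟩
  exact ⟨fun φs _ h k hk => schlafliExpectation_conicalQuermass hk φs h,
    fun φ _ hφ h k _ hk => coverEfronExpectation_conicalQuermass hφ h hk⟩
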